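/- Let $\overline{\mathbb Q}\subset\mathbb C$ be the field of algebraic numbers, let $M_0$ be an irreducible smooth projective curve over $\overline{\mathbb Q}$, and let $E_0$ be a vector bundle (locally free $\mathcal O_{M_0}$-module of finite rank) on $M_0$. Let $M=M_0\times_{\operatorname{Spec}\overline{\mathbb Q}}\operatorname{Spec}\mathbb C$, and for an $\mathcal O_{M_0}$-module $G$ write $G\otimes_{\overline{\mathbb Q}}\mathbb C$ for its pullback to $M$. Put $E=E_0\otimes_{\overline{\mathbb Q}}\mathbb C$. Let $V$ be a direct summand of $E$, that is, suppose that there are $\mathcal O_M$-modules $V$ and $F$ with homomorphisms $V\to E$ and $F\to E$ such that the induced homomorphism $V\oplus F\to E$ is an isomorphism (for instance, $V,F\subset E$ are complementary algebraic subbundles). Then there is a vector bundle $V_0$ on $M_0$ such that $V$ is isomorphic to $V_0\otimes_{\overline{\mathbb Q}}\mathbb C$. -/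

import Mathlib

open CategoryTheory AlgebraicGeometry

noncomputable section

/-- The field `ℚ̄` of algebraic numbers, as a subfield of `ℂ`. -/
abbrev QBar : Type := algebraicClosure ℚ ℂ

/-- Projective `n`-space over a field `K`: `Proj` of `K[x₀, …, xₙ]` with its standard grading. -/
def projectiveSpace (K : Type) [Field K] (n : ℕ) : Scheme.{0} :=
  letI := MvPolynomial.gradedAlgebra (σ := Fin (n + 1)) (R := K)
  Proj (MvPolynomial.homogeneousSubmodule (Fin (n + 1)) K)

/-- The structure morphism of projective `n`-space, induced by the inclusion of `K` as the
constants of degree `0`. -/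
def projectiveSpaceToSpec (K : Type) [Field K] (n : ℕ) :
    projectiveSpace K n ⟶ Spec (CommRingCat.of K) :=
  letI := MvPolynomial.gradedAlgebra (σ := Fin (n + 1)) (R := K)
  Proj.toSpecZero (MvPolynomial.homogeneousSubmodule (Fin (n + 1)) K) ≫
    Spec.map (CommRingCat.ofHom
      (algebraMap K (MvPolynomial.homogeneousSubmodule (Fin (n + 1)) K 0)))

/-- A `K`-scheme `p : X ⟶ Spec K` is an irreducible smooth projective curve over `K`: `X` is
irreducible, `p` is smooth of relative dimension one, and `X` is isomorphic over `K` to a closed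
subscheme of some projective space. -/
structure IsSmoothProjectiveCurve {K : Type} [Field K] {X : Scheme.{0}}
    (p : X ⟶ Spec (CommRingCat.of K)) : Prop where
  irreducible : IrreducibleSpace X
  smooth : SmoothOfRelativeDimension 1 p
  projective : ∃ (n : ℕ) (i : X ⟶ projectiveSpace K n),
    IsClosedImmersion i ∧ i ≫ projectiveSpaceToSpec K n = p

/-- A vector bundle on a scheme `X`, seen as its sheaf of sections: an `𝒪_X`-module that is free of
finite rank on an open neighbourhood of each point. -/
def IsVectorBundle {X : Scheme.{0}} (E : X.Modules) : Prop :=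
  ∀ x : X, ∃ U : X.Opens, x ∈ U ∧ ∃ r : ℕ,
    Nonempty (E.restrict U.ι ≅ (SheafOfModules.free (Fin r) : (U : Scheme.{0}).Modules))

/-- The base change `X_ℂ = X ×_{Spec ℚ̄} Spec ℂ` of a `ℚ̄`-scheme `p : X ⟶ Spec ℚ̄`. -/
def complexification {X : Scheme.{0}} (p : X ⟶ Spec (CommRingCat.of QBar)) : Scheme.{0} :=
  Limits.pullback p (Spec.map (CommRingCat.ofHom (algebraMap QBar ℂ)))

/-- The projection `X_ℂ ⟶ X`. -/
def complexificationProj {X : Scheme.{0}} (p : X ⟶ Spec (CommRingCat.of QBar)) :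
    complexification p ⟶ X :=
  Limits.pullback.fst p (Spec.map (CommRingCat.ofHom (algebraMap QBar ℂ)))

/-- The base change `E ⊗_{ℚ̄} ℂ` to `X_ℂ` of an `𝒪_X`-module `E`: its pullback along the
projection `X_ℂ ⟶ X`. -/
def baseChangeToComplex {X : Scheme.{0}} (p : X ⟶ Spec (CommRingCat.of QBar)) (E : X.Modules) :
    (complexification p).Modules :=
  (Scheme.Modules.pullback (complexificationProj p)).obj E

end

-- Write `k` for `ℚ̄` and `K` for `ℂ`. A summand of `E₀ ⊗ K` is the image of an idempotent
-- endomorphism `e`; it suffices to conjugate `e` into the base change of an idempotent `e₀` of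
-- `E₀`, whose image is then `V₀`.
--
-- Finitely many affine charts carrying frames of `E₀` cover the curve, so the matrices of `e` have
-- entries in `𝒪(W) ⊗ R` for a single finitely generated subalgebra `R ⊆ K`. The Nullstellensatz
-- gives a `k`-point `σ` of `R`; extend it to a `k`-linear functional `l : K → k`. Applying `l` to
-- coefficients turns `e` into an endomorphism `e₀` of `E₀` (`exists_hom_functional`). On the
-- matrices involved `l` acts as the ring homomorphism `σ`, so `e₀` is idempotent.
--
-- With `e₁ = e₀ ⊗ K`, put `u = e₁ ≫ e + (1 - e₁) ≫ (1 - e)`, which satisfies `e₁ ≫ u = u ≫ e`. It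
-- specializes to `1` under `σ`, so its determinant is not nilpotent (`not_isNilpotent_det`). The
-- determinant is a global function on the base change of a proper irreducible scheme, hence
-- nilpotent or a unit (`isNilpotent_or_isUnit`). So `u` is an isomorphism
-- (`exists_idempotent_conjugate`).
--
-- Finally, the image of `e₀` is locally free because an idempotent matrix over a local ring has
-- free image, and a splitting on a stalk spreads to a neighbourhood.

universe u

noncomputable section

/-! ### Sections of modules and morphisms acting on them -/

namespace AlgebraicGeometry.Scheme.Modules

open TopologicalSpace Limits

variable {X Y : Scheme.{u}} {E F G : X.Modules} {U V W : X.Opens}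

/-- Restriction of functions, as a ring homomorphism. -/
def resFun (h : V ≤ U) : Γ(X, U) →+* Γ(X, V) := (X.presheaf.map (homOfLE h).op).hom

/-- Restriction of sections of a module, as an additive map. -/
def res (E : X.Modules) (h : V ≤ U) : Γ(E, U) →+ Γ(E, V) := (E.presheaf.map (homOfLE h).op).hom

@[simp] lemma resFun_resFun (h : V ≤ U) (h' : W ≤ V) (a : Γ(X, U)) :
    resFun h' (resFun h a) = resFun (h'.trans h) a := by
  simp only [resFun]
  rw [← RingHom.comp_apply, ← CommRingCat.hom_comp, ← Functor.map_comp]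
  rfl

@[simp] lemma res_res (h : V ≤ U) (h' : W ≤ V) (x : Γ(E, U)) :
    E.res h' (E.res h x) = E.res (h'.trans h) x := by
  simp only [res]
  rw [← AddMonoidHom.comp_apply, ← AddCommGrpCat.hom_comp, ← Functor.map_comp]
  rfl

@[simp] lemma res_self (x : Γ(E, U)) : E.res le_rfl x = x := by
  simp only [res]
  change (E.presheaf.map (𝟙 _)).hom x = x
  simp

lemma res_smul (h : V ≤ U) (a : Γ(X, U)) (x : Γ(E, U)) :
    E.res h (a • x) = resFun h a • E.res h x :=
  E.map_smul (homOfLE h) a x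

/-- The action of a morphism on sections, as a linear map. -/
def Hom.appLin (φ : E ⟶ F) (U : X.Opens) : Γ(E, U) →ₗ[Γ(X, U)] Γ(F, U) where
  toFun := φ.app U
  map_add' := map_add _
  map_smul' := Hom.app_smul φ

lemma appLin_res (φ : E ⟶ F) (h : V ≤ U) (x : Γ(E, U)) :
    φ.appLin V (E.res h x) = F.res h (φ.appLin U x) :=
  congr($(φ.mapPresheaf.naturality (homOfLE h).op).hom x)

@[simp] lemma appLin_comp (φ : E ⟶ F) (ψ : F ⟶ G) : (φ ≫ ψ).appLin U = ψ.appLin U ∘ₗ φ.appLin U :=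
  rfl
@[simp] lemma appLin_id : (𝟙 E : E ⟶ E).appLin U = LinearMap.id := rfl
@[simp] lemma appLin_add (φ ψ : E ⟶ F) : (φ + ψ).appLin U = φ.appLin U + ψ.appLin U := rfl
@[simp] lemma appLin_sub (φ ψ : E ⟶ F) : (φ - ψ).appLin U = φ.appLin U - ψ.appLin U := rfl
@[simp] lemma appLin_zero : (0 : E ⟶ F).appLin U = 0 := rfl
lemma appLin_sum {ι : Type*} (s : Finset ι) (φ : ι → (E ⟶ F)) :
    (∑ i ∈ s, φ i).appLin U = ∑ i ∈ s, (φ i).appLin U := by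
  classical
  induction s using Finset.induction_on with
  | empty => simp
  | insert i s hi ih => simp [Finset.sum_insert hi, ih]

lemma hom_ext_appLin {φ ψ : E ⟶ F} (h : ∀ U, φ.appLin U = ψ.appLin U) : φ = ψ :=
  hom_ext _ _ fun U ↦ by ext x; exact congr($(h U) x)

/-- The morphism of modules with given compatible actions on sections. -/
def homMk (φ : ∀ U, Γ(E, U) →ₗ[Γ(X, U)] Γ(F, U))
    (hφ : ∀ (U V : X.Opens) (h : V ≤ U) (x : Γ(E, U)), φ V (E.res h x) = F.res h (φ U x)) :
    E ⟶ F where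
  val :=
    { app U := ModuleCat.ofHom (X := E.val.obj U) (Y := F.val.obj U) (φ U.unop)
      naturality {U V} f := by
        ext x
        exact hφ _ _ (leOfHom f.unop) x }

@[simp] lemma appLin_homMk (φ : ∀ U, Γ(E, U) →ₗ[Γ(X, U)] Γ(F, U))
    (hφ : ∀ (U V : X.Opens) (h : V ≤ U) (x : Γ(E, U)), φ V (E.res h x) = F.res h (φ U x)) :
    (homMk φ hφ).appLin U = φ U := rfl

lemma isIso_of_bijective {φ : E ⟶ F} (h : ∀ U, Function.Bijective (φ.appLin U)) : IsIso φ := by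
  rw [Hom.isIso_iff_isIso_app]
  intro U
  rw [ConcreteCategory.isIso_iff_bijective]
  exact h U

lemma bijective_appLin (φ : E ⟶ F) [IsIso φ] : Function.Bijective (φ.appLin U) :=
  (ConcreteCategory.isIso_iff_bijective (φ.app U)).mp inferInstance

/-! ### Frames and the structure sheaf -/

section Frame

variable {ι : Type*} [Fintype ι]

/-- A frame of a module over an open set: sections over it whose restrictions to each smaller open
set form a basis of the sections there. -/
def IsFrame (E : X.Modules) (U : X.Opens) (s : ι → Γ(E, U)) : Prop :=
  ∀ (V : X.Opens) (h : V ≤ U),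
    Function.Bijective fun c : ι → Γ(X, V) ↦ ∑ i, c i • E.res h (s i)

lemma IsFrame.mono {s : ι → Γ(E, U)} (hs : IsFrame E U s) (h : V ≤ U) :
    IsFrame E V fun i ↦ E.res h (s i) := fun W hW ↦ by
  simpa using hs W (hW.trans h)

lemma IsFrame.map {s : ι → Γ(E, U)} (hs : IsFrame E U s) (φ : E ⟶ F) [IsIso φ] :
    IsFrame F U fun i ↦ φ.appLin U (s i) := fun V h ↦ by
  simpa [Function.comp_def, map_sum, appLin_res] using (bijective_appLin φ).comp (hs V h)

/-- The basis given by a frame. -/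
def IsFrame.basis {s : ι → Γ(E, U)} (hs : IsFrame E U s) : Module.Basis ι Γ(X, U) Γ(E, U) :=
  .ofEquivFun (LinearEquiv.ofBijective (Fintype.linearCombination Γ(X, U) s) (by
    convert hs U le_rfl using 2 with c
    simp [Fintype.linearCombination_apply])).symm

@[simp] lemma IsFrame.basis_apply {s : ι → Γ(E, U)} (hs : IsFrame E U s) (i : ι) :
    hs.basis i = s i := by
  classical
  simp [IsFrame.basis, Fintype.linearCombination_apply_single]

/-- The structure sheaf as a module. -/
abbrev unit (X : Scheme.{u}) : X.Modules := SheafOfModules.unit X.ringCatSheaf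

/-- Functions as sections of the structure sheaf. -/
def toUnit (U : X.Opens) : Γ(X, U) ≃ₗ[Γ(X, U)] Γ(unit X, U) where
  toFun a := a
  invFun a := a
  map_add' _ _ := rfl
  map_smul' _ _ := rfl
  left_inv _ := rfl
  right_inv _ := rfl

lemma toUnit_res (h : V ≤ U) (a : Γ(X, U)) :
    (unit X).res h (toUnit U a) = toUnit V (resFun h a) := rfl

lemma toUnit_eq_smul (a : Γ(X, U)) : toUnit U a = a • (unit X).res le_top (toUnit ⊤ 1) := by
  rw [toUnit_res, ← LinearEquiv.map_smul]
  simp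

/-- The morphism from the structure sheaf given by a global section. -/
def unitDesc (s : Γ(E, ⊤)) : unit X ⟶ E :=
  homMk (fun _ ↦ LinearMap.toSpanSingleton _ _ (E.res le_top s) ∘ₗ (toUnit _).symm.toLinearMap)
    fun U V h x ↦ by
      obtain ⟨a, rfl⟩ := (toUnit U).surjective x
      simp [toUnit_res, res_smul]

@[simp] lemma unitDesc_one (s : Γ(E, ⊤)) : (unitDesc s).appLin ⊤ (toUnit ⊤ 1) = s := by
  rw [unitDesc, appLin_homMk]
  simp

/-- The structure sheaf corepresents global sections; this identifies its pullback by Yoneda later.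
-/
lemma bijective_appLin_one (E : X.Modules) :
    Function.Bijective fun φ : unit X ⟶ E ↦ φ.appLin ⊤ (toUnit ⊤ 1) := by
  refine ⟨fun φ ψ h ↦ hom_ext_appLin fun U ↦ LinearMap.ext fun x ↦ ?_,
    fun s ↦ ⟨unitDesc s, unitDesc_one s⟩⟩
  obtain ⟨a, rfl⟩ := (toUnit U).surjective x
  rw [toUnit_eq_smul, LinearMap.map_smul, LinearMap.map_smul, appLin_res, appLin_res]
  exact congr(a • E.res le_top $h)

/-- The hypotheses are the biproduct identities. Being equations between morphisms, they survive any
additive functor, pullback in particular. -/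
lemma isFrame_of_splitting [DecidableEq ι] (a : ι → (unit X ⟶ E)) (b : ι → (E ⟶ unit X))
    (hab : ∀ i j, a i ≫ b j = if i = j then 𝟙 _ else 0) (hba : ∑ i, b i ≫ a i = 𝟙 E) :
    IsFrame E ⊤ fun i ↦ (a i).appLin ⊤ (toUnit ⊤ 1) := by
  intro V hV
  have h1 (c : ι → Γ(X, V)) : ∑ i, c i • E.res hV ((a i).appLin ⊤ (toUnit ⊤ 1)) =
      ∑ i, (a i).appLin V (toUnit V (c i)) := by
    refine Finset.sum_congr rfl fun i _ ↦ ?_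
    rw [← appLin_res, ← LinearMap.map_smul, toUnit_eq_smul (c i)]
  simp only [h1]
  refine Function.bijective_iff_has_inverse.mpr
    ⟨fun x j ↦ (toUnit V).symm ((b j).appLin V x), fun c ↦ ?_, fun x ↦ ?_⟩
  · ext j
    simp only [map_sum]
    have (i : ι) : (b j).appLin V ((a i).appLin V (toUnit V (c i))) =
        if i = j then toUnit V (c i) else 0 := by
      rw [← LinearMap.comp_apply, ← appLin_comp, hab]
      split_ifs <;> rfl
    simp only [this, apply_ite, map_zero, LinearEquiv.symm_apply_apply]
    simp
  · have := congr(($hba).appLin V x)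
    simpa [appLin_sum] using this

/-- The free module of finite rank. -/
abbrev free (X : Scheme.{u}) (ι : Type u) : X.Modules :=
  SheafOfModules.free (R := X.ringCatSheaf) ι

end Frame

/-! ### Free modules -/

section Free

variable {ι : Type u}

/-- The inclusion of a summand into the free module. -/
def ιFree (X : Scheme.{u}) (i : ι) : unit X ⟶ free X ι := SheafOfModules.ιFree i

/-- The morphism out of the free module with given components. -/
def freeDesc (φ : ι → (unit X ⟶ E)) : free X ι ⟶ E :=
  Cofan.IsColimit.desc (SheafOfModules.isColimitFreeCofan (R := X.ringCatSheaf) ι) φ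

@[simp]
lemma ιFree_freeDesc (φ : ι → (unit X ⟶ E)) (i : ι) : ιFree X i ≫ freeDesc φ = φ i :=
  Cofan.IsColimit.fac (SheafOfModules.isColimitFreeCofan (R := X.ringCatSheaf) ι) φ i

lemma free_hom_ext {φ ψ : free X ι ⟶ E} (h : ∀ i, ιFree X i ≫ φ = ιFree X i ≫ ψ) : φ = ψ :=
  Cofan.IsColimit.hom_ext (SheafOfModules.isColimitFreeCofan (R := X.ringCatSheaf) ι) _ _ h

open Classical in
/-- The projections of the free module. -/
def πFree (X : Scheme.{u}) (i : ι) : free X ι ⟶ unit X :=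
  freeDesc fun j ↦ if j = i then 𝟙 _ else 0

variable [Fintype ι] in
lemma sum_πFree_ιFree : ∑ i, πFree X i ≫ ιFree X i = 𝟙 (free X ι) := by
  classical
  refine free_hom_ext fun j ↦ ?_
  simp only [Preadditive.comp_sum, πFree, ← Category.assoc, ιFree_freeDesc]
  simp [ite_comp]

open Classical in
lemma ιFree_πFree (i j : ι) : ιFree X i ≫ πFree X j = if i = j then 𝟙 _ else 0 := by
  simp [πFree]

/-- The tautological frame of a free module. -/
def stdFrame (X : Scheme.{u}) (i : ι) : Γ(free X ι, ⊤) := (ιFree X i).appLin ⊤ (toUnit ⊤ 1)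

variable [Fintype ι]

lemma isFrame_stdFrame : IsFrame (free X ι) ⊤ (stdFrame X) := by
  classical
  exact isFrame_of_splitting _ _ ιFree_πFree sum_πFree_ιFree

lemma IsFrame.nonempty_iso {s : ι → Γ(E, ⊤)} (hs : IsFrame E ⊤ s) :
    ∃ φ : free X ι ≅ E, ∀ i, φ.hom.appLin ⊤ (stdFrame X i) = s i := by
  let ψ : free X ι ⟶ E := freeDesc fun i ↦ unitDesc (s i)
  have hψ (i : ι) : ψ.appLin ⊤ (stdFrame X i) = s i := by
    rw [stdFrame, ← LinearMap.comp_apply, ← appLin_comp, ιFree_freeDesc, unitDesc_one]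
  have : IsIso ψ := isIso_of_bijective fun V ↦ by
    refine (Function.Bijective.of_comp_iff _ (isFrame_stdFrame V le_top)).mp ?_
    simpa [Function.comp_def, map_sum, appLin_res, hψ] using hs V le_top
  exact ⟨asIso ψ, hψ⟩

end Free

end AlgebraicGeometry.Scheme.Modules

namespace AlgebraicGeometry.Scheme.Modules

open TopologicalSpace Limits

variable {X Y : Scheme.{u}} {E F G : X.Modules} {U V W : X.Opens}

/-! ### Restriction to open subschemes -/

section Restrict

variable {ι : Type*} [Fintype ι]

lemma image_ι_le (V : (U : Scheme.{u}).Opens) : U.ι ''ᵁ V ≤ U := by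
  simpa using U.ι.image_mono (le_top (a := V))

lemma exists_image_ι_eq (h : V ≤ U) : ∃ V' : (U : Scheme.{u}).Opens, U.ι ''ᵁ V' = V :=
  ⟨U.ι ⁻¹ᵁ V, by
    rw [Scheme.Hom.image_preimage_eq_opensRange_inf, Scheme.Opens.opensRange_ι]
    exact inf_eq_right.mpr h⟩

/-- Functions on an open subset of an open subscheme. -/
def imageFunEquiv (U : X.Opens) (V : (U : Scheme.{u}).Opens) : Γ(X, U.ι ''ᵁ V) ≃+* Γ(U, V) :=
  (U.ι.appIso V).commRingCatIsoToRingEquiv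

/-- Sections of a restriction over an open subset of an open subscheme. -/
def imageSecEquiv (E : X.Modules) (U : X.Opens) (V : (U : Scheme.{u}).Opens) :
    Γ(E, U.ι ''ᵁ V) ≃+ Γ(E.restrict U.ι, V) :=
  AddEquiv.refl _

lemma imageSecEquiv_smul {V : (U : Scheme.{u}).Opens} (a : Γ(X, U.ι ''ᵁ V))
    (x : Γ(E, U.ι ''ᵁ V)) :
    imageSecEquiv E U V (a • x) = imageFunEquiv U V a • imageSecEquiv E U V x := by
  obtain ⟨b, rfl⟩ := (imageFunEquiv U V).symm.surjective a
  rw [RingEquiv.apply_symm_apply]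
  rfl

lemma imageSecEquiv_res {V V' : (U : Scheme.{u}).Opens} (h : V' ≤ V) (x : Γ(E, U.ι ''ᵁ V)) :
    imageSecEquiv E U V' (E.res (U.ι.image_mono h) x) =
      (E.restrict U.ι).res h (imageSecEquiv E U V x) :=
  rfl

/-- The restriction to an open subscheme of a section. -/
def restrictSec (E : X.Modules) (U : X.Opens) (V : (U : Scheme.{u}).Opens) :
    Γ(E, U) →+ Γ(E.restrict U.ι, V) :=
  (imageSecEquiv E U V).toAddMonoidHom.comp (E.res (image_ι_le V))

lemma restrictSec_res {V V' : (U : Scheme.{u}).Opens} (h : V' ≤ V) (x : Γ(E, U)) :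
    (E.restrict U.ι).res h (restrictSec E U V x) = restrictSec E U V' x := by
  refine (imageSecEquiv_res h _).symm.trans ?_
  exact congr(imageSecEquiv E U V' $(res_res (image_ι_le V) (U.ι.image_mono h) x))

lemma bijective_restrict_iff (s : ι → Γ(E, U)) (V : (U : Scheme.{u}).Opens) :
    (Function.Bijective fun c : ι → Γ(U, V) ↦ ∑ i, c i • restrictSec E U V (s i)) ↔
    Function.Bijective fun c : ι → Γ(X, U.ι ''ᵁ V) ↦ ∑ i, c i • E.res (image_ι_le V) (s i) := by
  rw [← (imageSecEquiv E U V).bijective.of_comp_iff',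
    ← ((Equiv.refl ι).arrowCongr (imageFunEquiv U V).toEquiv).bijective.of_comp_iff]
  simp [Function.comp_def, map_sum, imageSecEquiv_smul, restrictSec]

lemma isFrame_restrict_iff (s : ι → Γ(E, U)) :
    IsFrame (E.restrict U.ι) ⊤ (fun i ↦ restrictSec E U ⊤ (s i)) ↔ IsFrame E U s := by
  simp only [IsFrame, restrictSec_res]
  constructor
  · intro h V hV
    obtain ⟨V, rfl⟩ := exists_image_ι_eq hV
    exact (bijective_restrict_iff s V).mp (h V le_top)
  · exact fun h V hV ↦ (bijective_restrict_iff s V).mpr (h _ (image_ι_le V))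

lemma restrictSec_surjective : Function.Surjective (restrictSec E U ⊤) := fun x ↦
  ⟨E.res U.ι_image_top.ge ((imageSecEquiv E U ⊤).symm x), by simp [restrictSec]⟩

lemma IsFrame.nonempty_restrict_iso {ι : Type u} [Fintype ι] {s : ι → Γ(E, U)}
    (hs : IsFrame E U s) : Nonempty (E.restrict U.ι ≅ free U ι) :=
  let ⟨φ, _⟩ := ((isFrame_restrict_iff s).mpr hs).nonempty_iso
  ⟨φ.symm⟩

lemma exists_isFrame_of_restrict_iso {ι : Type u} [Fintype ι] (φ : E.restrict U.ι ≅ free U ι) :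
    ∃ s : ι → Γ(E, U), IsFrame E U s := by
  have := (isFrame_stdFrame (X := U) (ι := ι)).map φ.inv
  choose s hs using fun i ↦ restrictSec_surjective (E := E) (φ.inv.appLin ⊤ (stdFrame U i))
  refine ⟨s, (isFrame_restrict_iff s).mp ?_⟩
  simpa [hs] using this

end Restrict

/-! ### Pullback of sections and of global frames -/

section Pullback

variable (f : Y ⟶ X)

/-- The pullback of sections along a morphism of schemes. -/
def pullbackSec (E : X.Modules) (U : X.Opens) : Γ(E, U) →+ Γ((pullback f).obj E, f ⁻¹ᵁ U) :=
  (((pullbackPushforwardAdjunction f).unit.app E).app U).hom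

/-- The pullback of functions along a morphism of schemes. -/
def pullbackFun (U : X.Opens) : Γ(X, U) →+* Γ(Y, f ⁻¹ᵁ U) := (f.app U).hom

lemma pullbackFun_res (h : V ≤ U) (a : Γ(X, U)) :
    pullbackFun f V (resFun h a) = resFun (f.preimage_mono h) (pullbackFun f U a) :=
  congr($(f.naturality (homOfLE h).op).hom a)

lemma pullbackSec_smul (a : Γ(X, U)) (x : Γ(E, U)) :
    pullbackSec f E U (a • x) = pullbackFun f U a • pullbackSec f E U x :=
  ((pullbackPushforwardAdjunction f).unit.app E).app_smul a x

lemma pullbackSec_res (h : V ≤ U) (x : Γ(E, U)) :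
    pullbackSec f E V (E.res h x) =
      ((pullback f).obj E).res (f.preimage_mono h) (pullbackSec f E U x) :=
  appLin_res ((pullbackPushforwardAdjunction f).unit.app E) h x

lemma pullback_map_appLin (φ : E ⟶ F) (x : Γ(E, U)) :
    ((pullback f).map φ).appLin (f ⁻¹ᵁ U) (pullbackSec f E U x) =
      pullbackSec f F U (φ.appLin U x) :=
  congr(($((pullbackPushforwardAdjunction f).unit.naturality φ)).app U x).symm

/-- The pullback of the structure sheaf is the structure sheaf. -/
lemma exists_pullback_unit_iso : ∃ θ : (pullback f).obj (unit X) ≅ unit Y,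
    θ.hom.appLin (f ⁻¹ᵁ ⊤) (pullbackSec f (unit X) ⊤ (toUnit ⊤ 1)) = toUnit (f ⁻¹ᵁ ⊤) 1 := by
  let θ₀ : unit X ⟶ (pushforward f).obj (unit Y) :=
    homMk (fun U ↦
      { toFun := fun a ↦ toUnit (f ⁻¹ᵁ U) (pullbackFun f U ((toUnit U).symm a))
        map_add' := fun a b ↦ map_add (pullbackFun f U) a b
        map_smul' := fun a b ↦ map_mul (pullbackFun f U) a b })
      fun _ _ ↦ pullbackFun_res f
  let θ := ((pullbackPushforwardAdjunction f).homEquiv _ _).symm θ₀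
  have hθ : (pullbackPushforwardAdjunction f).unit.app _ ≫ (pushforward f).map θ = θ₀ :=
    (pullbackPushforwardAdjunction f).homEquiv_unit _ _ _ |>.symm.trans (Equiv.apply_symm_apply _ _)
  -- By Yoneda: morphisms from either module to `G` are the global sections of `G`, by adjunction on
  -- one side and `bijective_appLin_one` on both, and `θ` matches the two descriptions.
  have : IsIso θ := by
    rw [isIso_iff_coyoneda_map_bijective]
    intro G
    rw [← ((pullbackPushforwardAdjunction f).homEquiv _ _).bijective.of_comp_iff',
      ← (bijective_appLin_one _).of_comp_iff']
    convert! (bijective_appLin_one G) using 1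
    ext φ
    have : ((pullbackPushforwardAdjunction f).homEquiv _ _) (θ ≫ φ) =
        θ₀ ≫ (pushforward f).map φ := by
      rw [Adjunction.homEquiv_naturality_right, Equiv.apply_symm_apply]
    refine congr($(this).appLin ⊤ (toUnit ⊤ 1)).trans ?_
    exact congr(φ.appLin (f ⁻¹ᵁ ⊤) $(map_one (pullbackFun f ⊤)))
  refine ⟨@asIso _ _ _ _ θ this, ?_⟩
  exact congr($(hθ).appLin ⊤ (toUnit ⊤ 1)).trans (map_one (pullbackFun f ⊤))

lemma IsFrame.pullback_top {ι : Type u} [Fintype ι] {s : ι → Γ(E, ⊤)} (hs : IsFrame E ⊤ s) :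
    IsFrame ((pullback f).obj E) (f ⁻¹ᵁ ⊤) fun i ↦ pullbackSec f E ⊤ (s i) := by
  classical
  obtain ⟨φ, hφ⟩ := hs.nonempty_iso
  obtain ⟨θ, hθ⟩ := exists_pullback_unit_iso f
  have key : IsFrame ((pullback f).obj (free X ι)) ⊤ fun i ↦
      ((θ.inv ≫ (pullback f).map (ιFree X i)).appLin ⊤ (toUnit ⊤ 1)) := by
    refine isFrame_of_splitting _ (fun i ↦ (pullback f).map (πFree X i) ≫ θ.hom) ?_ ?_
    · intro i j
      rw [Category.assoc, ← Functor.map_comp_assoc, ιFree_πFree]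
      split_ifs <;> simp
    · simp only [Category.assoc, Iso.hom_inv_id_assoc, ← Functor.map_comp, ← Functor.map_sum,
        sum_πFree_ιFree]
      exact CategoryTheory.Functor.map_id _ _
  convert! (key.mono (le_top : f ⁻¹ᵁ ⊤ ≤ ⊤)).map ((pullback f).map φ.hom) using 2 with i
  rw [← hφ, ← appLin_res, toUnit_res, map_one, ← hθ]
  have h (x) : (θ.inv ≫ (pullback f).map (ιFree X i)).appLin (f ⁻¹ᵁ ⊤)
      (θ.hom.appLin _ x) = ((pullback f).map (ιFree X i)).appLin _ x := by
    rw [← LinearMap.comp_apply, ← appLin_comp, Iso.hom_inv_id_assoc]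
  rw [h, pullback_map_appLin, pullback_map_appLin]
  rfl

end Pullback

end AlgebraicGeometry.Scheme.Modules

/-! ### Pullback of frames over open subsets -/

namespace AlgebraicGeometry.Scheme.Modules

open TopologicalSpace Limits

variable {X Y : Scheme.{u}} {E F G : X.Modules} {U V W : X.Opens} (f : Y ⟶ X)

/-- Pullback commutes with restriction to an open subscheme, compatibly with sections. -/
lemma exists_pullback_restrict_iso (E : X.Modules) (U : X.Opens) :
    ∃ θ : (pullback (f ∣_ U)).obj (E.restrict U.ι) ≅ ((pullback f).obj E).restrict (f ⁻¹ᵁ U).ι,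
      ∀ s : Γ(E, U), θ.hom.appLin ((f ∣_ U) ⁻¹ᵁ ⊤)
        (pullbackSec (f ∣_ U) (E.restrict U.ι) ⊤ (restrictSec E U ⊤ s)) =
      restrictSec ((pullback f).obj E) (f ⁻¹ᵁ U) ((f ∣_ U) ⁻¹ᵁ ⊤) (pullbackSec f E U s) := by
  -- Both composites are left adjoint to the same pushforward, so they agree by uniqueness of left
  -- adjoints. Compatibility with the units is the statement about sections.
  let adj₁ := (restrictAdjunction U.ι).comp (pullbackPushforwardAdjunction (f ∣_ U))
  let adj₂ := (pullbackPushforwardAdjunction f).comp (restrictAdjunction (f ⁻¹ᵁ U).ι)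
  let α : pushforward (f ⁻¹ᵁ U).ι ⋙ pushforward f ≅ pushforward (f ∣_ U) ⋙ pushforward U.ι :=
    pushforwardComp _ _ ≪≫ pushforwardCongr (morphismRestrict_ι f U).symm ≪≫
      (pushforwardComp _ _).symm
  let adj₃ := adj₂.ofNatIsoRight α
  let θ : (pullback (f ∣_ U)).obj (E.restrict U.ι) ≅
      ((pullback f).obj E).restrict (f ⁻¹ᵁ U).ι := (adj₁.leftAdjointUniq adj₃).app E
  refine ⟨θ, fun s ↦ ?_⟩
  have hU : (⊤ : (U : Scheme.{u}).Opens) ≤ U.ι ⁻¹ᵁ U := U.ι_preimage_self.ge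
  have h := congr($(adj₁.unit_leftAdjointUniq_hom_app adj₃ E).appLin U s)
  have h1 : θ.hom.appLin ((f ∣_ U) ⁻¹ᵁ U.ι ⁻¹ᵁ U)
      (pullbackSec (f ∣_ U) (E.restrict U.ι) (U.ι ⁻¹ᵁ U) (restrictSec E U (U.ι ⁻¹ᵁ U) s)) =
      (((pullback f).obj E).restrict (f ⁻¹ᵁ U).ι).res
        (by rw [← Scheme.Hom.comp_preimage, ← Scheme.Hom.comp_preimage, morphismRestrict_ι])
        (restrictSec ((pullback f).obj E) (f ⁻¹ᵁ U) ((f ⁻¹ᵁ U).ι ⁻¹ᵁ f ⁻¹ᵁ U)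
          (pullbackSec f E U s)) := h
  rw [restrictSec_res] at h1
  have h2 := congr((((pullback f).obj E).restrict (f ⁻¹ᵁ U).ι).res
    ((f ∣_ U).preimage_mono hU) $h1)
  rw [← appLin_res, ← pullbackSec_res (h := hU), restrictSec_res,
    restrictSec_res] at h2
  exact h2

lemma IsFrame.pullback {ι : Type u} [Fintype ι] {s : ι → Γ(E, U)} (hs : IsFrame E U s) :
    IsFrame ((pullback f).obj E) (f ⁻¹ᵁ U) fun i ↦ pullbackSec f E U (s i) := by
  obtain ⟨θ, hθ⟩ := exists_pullback_restrict_iso f E U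
  rw [← isFrame_restrict_iff]
  have := (((isFrame_restrict_iff s).mpr hs).pullback_top (f ∣_ U)).map θ.hom
  simp only [hθ] at this
  exact this

end AlgebraicGeometry.Scheme.Modules

/-! ### Gluing morphisms from a basis, and determinants -/

namespace AlgebraicGeometry.Scheme.Modules

open TopologicalSpace Limits

variable {X Y : Scheme.{u}} {E F G : X.Modules} {U V W : X.Opens}

/-- The underlying sheaf of abelian groups. -/
def abSheaf (E : X.Modules) : TopCat.Sheaf Ab X := ⟨E.presheaf, E.isSheaf⟩

lemma eq_of_res_eq {x y : Γ(E, U)}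
    (h : ∀ p ∈ U, ∃ (V : X.Opens) (hV : V ≤ U), p ∈ V ∧ E.res hV x = E.res hV y) : x = y := by
  choose V hV hp hxy using h
  refine E.abSheaf.eq_of_locally_eq' (fun p : U ↦ V p p.2) U (fun p ↦ homOfLE (hV p p.2))
    (fun p hpU ↦ ?_) x y fun p ↦ hxy p p.2
  exact Opens.mem_iSup.mpr ⟨⟨p, hpU⟩, hp p hpU⟩

section Basis

variable {κ : Type*} {B : κ → X.Opens} (hB : Opens.IsBasis (Set.range B))
include hB

lemma eq_of_basis {x y : Γ(E, U)} (h : ∀ k (hk : B k ≤ U), E.res hk x = E.res hk y) : x = y := by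
  refine eq_of_res_eq fun p hp ↦ ?_
  obtain ⟨_, ⟨k, rfl⟩, hpk, hk⟩ := Opens.isBasis_iff_nbhd.mp hB hp
  exact ⟨B k, hk, hpk, h k hk⟩

lemma exists_hom_of_basis (φ : ∀ k, Γ(E, B k) →ₗ[Γ(X, B k)] Γ(F, B k))
    (hφ : ∀ k l (h : B l ≤ B k) (x : Γ(E, B k)), φ l (E.res h x) = F.res h (φ k x)) :
    ∃ ψ : E ⟶ F, ∀ k, ψ.appLin (B k) = φ k := by
  let α : (inducedFunctor B).op ⋙ E.presheaf ⟶ (inducedFunctor B).op ⋙ F.abSheaf.1 :=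
    { app k := AddCommGrpCat.ofHom (φ k.unop).toAddMonoidHom
      naturality {k l} g := by
        ext x
        exact hφ _ _ (leOfHom ((inducedFunctor B).map g.unop)) x }
  let β : E.presheaf ⟶ F.presheaf := TopCat.Sheaf.restrictHomEquivHom E.presheaf F.abSheaf hB α
  have hβ (k : κ) (x : Γ(E, B k)) : β.app (.op (B k)) x = φ k x :=
    congr($(TopCat.Sheaf.extend_hom_app E.presheaf F.abSheaf hB α k) x)
  have hres {U V : X.Opens} (h : V ≤ U) (x : Γ(E, U)) :
      β.app (.op V) (E.res h x) = F.res h (β.app (.op U) x) :=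
    congr($(β.naturality (homOfLE h).op) x)
  refine ⟨homMk (fun U ↦
    { toFun := β.app (.op U)
      map_add' := map_add _
      map_smul' := fun a x ↦ ?_ }) fun _ _ ↦ hres, fun k ↦ LinearMap.ext (hβ k)⟩
  -- The sheaf extension is only additive a priori; linearity is checked on basic opens, where it is
  -- given.
  refine eq_of_basis hB fun k hk ↦ ?_
  rw [← hres, res_smul, hβ, LinearMap.map_smul, RingHom.id_apply, res_smul, ← hres, hβ]

lemma hom_ext_of_basis {φ ψ : E ⟶ F} (h : ∀ k, φ.appLin (B k) = ψ.appLin (B k)) : φ = ψ :=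
  hom_ext_appLin fun U ↦ LinearMap.ext fun x ↦ eq_of_basis hB fun k hk ↦ by
    rw [← appLin_res, ← appLin_res, h]

lemma isIso_of_basis {φ : E ⟶ F} (h : ∀ k, Function.Bijective (φ.appLin (B k))) : IsIso φ := by
  let ψ : E.abSheaf ⟶ F.abSheaf := ⟨φ.mapPresheaf⟩
  have : IsIso ψ := TopCat.Sheaf.isIso_iff_isIso_basis hB fun k ↦
    (ConcreteCategory.isIso_iff_bijective (φ.app (B k))).mpr (h k)
  have : IsIso ((toPresheaf X).map φ) := inferInstanceAs (IsIso ((TopCat.Sheaf.forget _ _).map ψ))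
  exact isIso_of_reflects_iso φ (toPresheaf X)

end Basis

lemma isBasis_le_of_cover {κ : Type*} (U : κ → X.Opens) (hU : ∀ x, ∃ k, x ∈ U k) :
    Opens.IsBasis (Set.range fun V : {V : X.Opens // ∃ k, V ≤ U k} ↦ V.1) := by
  rw [Opens.isBasis_iff_nbhd]
  intro V x hx
  obtain ⟨k, hk⟩ := hU x
  exact ⟨V ⊓ U k, ⟨⟨V ⊓ U k, k, inf_le_right⟩, rfl⟩, ⟨hx, hk⟩, inf_le_left⟩

section Det

variable {ι κ : Type*} [Fintype ι]

lemma IsFrame.appLin_eq_toMatrix [DecidableEq ι] {s : ι → Γ(E, U)} (hs : IsFrame E U s)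
    (φ : E ⟶ E) (h : V ≤ U) :
    LinearMap.toMatrix (hs.mono h).basis (hs.mono h).basis (φ.appLin V) =
      (LinearMap.toMatrix hs.basis hs.basis (φ.appLin U)).map (resFun h) := by
  ext i j
  rw [LinearMap.toMatrix_apply, Matrix.map_apply, LinearMap.toMatrix_apply, IsFrame.basis_apply,
    IsFrame.basis_apply, appLin_res]
  have := congr(E.res h $(hs.basis.sum_repr (φ.appLin U (s j))))
  rw [← this, map_sum]
  simp_rw [res_smul, basis_apply]
  have := (hs.mono h).basis.repr_sum_self fun k ↦ resFun h (hs.basis.repr (φ.appLin U (s j)) k)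
  simp only [basis_apply] at this
  rw [this]

lemma IsFrame.det_res {s : ι → Γ(E, U)} (hs : IsFrame E U s) (φ : E ⟶ E) (h : V ≤ U) :
    LinearMap.det (φ.appLin V) = resFun h (LinearMap.det (φ.appLin U)) := by
  classical
  rw [← LinearMap.det_toMatrix hs.basis, ← LinearMap.det_toMatrix (hs.mono h).basis,
    hs.appLin_eq_toMatrix, RingHom.map_det]
  rfl

lemma IsFrame.bijective_of_isUnit_det {s : ι → Γ(E, U)} (hs : IsFrame E U s) {φ : E ⟶ E}
    (h : IsUnit (LinearMap.det (φ.appLin U))) : Function.Bijective (φ.appLin U) := by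
  have := Module.Free.of_basis hs.basis
  have := Module.Finite.of_basis hs.basis
  exact (Module.End.isUnit_iff _).mp ((LinearMap.isUnit_iff_isUnit_det _).mpr h)

/-- The determinant does not depend on the basis, so the local ones agree on overlaps; the ranks `r
k` may vary with `k`. -/
lemma exists_det {r : κ → ℕ} (U : κ → X.Opens) (hU : ∀ x, ∃ k, x ∈ U k)
    (s : ∀ k, Fin (r k) → Γ(E, U k)) (hs : ∀ k, IsFrame E (U k) (s k)) (φ : E ⟶ E) :
    ∃ d : Γ(X, ⊤), ∀ k, resFun le_top d = LinearMap.det (φ.appLin (U k)) := by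
  let D (k : κ) : Γ(X, U k) := LinearMap.det (φ.appLin (U k))
  obtain ⟨d, hd, -⟩ := X.sheaf.existsUnique_gluing' U ⊤ (fun k ↦ homOfLE le_top)
    (fun x _ ↦ Opens.mem_iSup.mpr (hU x)) D fun k l ↦ by
      exact ((hs k).det_res φ (inf_le_left : U k ⊓ U l ≤ U k)).symm.trans
        ((hs l).det_res φ (inf_le_right : U k ⊓ U l ≤ U l))
  exact ⟨d, hd⟩

lemma isIso_of_isUnit_det {r : κ → ℕ} (U : κ → X.Opens) (hU : ∀ x, ∃ k, x ∈ U k)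
    (s : ∀ k, Fin (r k) → Γ(E, U k)) (hs : ∀ k, IsFrame E (U k) (s k)) (φ : E ⟶ E)
    (h : ∀ k, IsUnit (LinearMap.det (φ.appLin (U k)))) : IsIso φ := by
  refine isIso_of_basis (isBasis_le_of_cover U hU) fun ⟨V, k, hV⟩ ↦ ?_
  refine ((hs k).mono hV).bijective_of_isUnit_det ?_
  rw [(hs k).det_res φ hV]
  exact (h k).map _

end Det

end AlgebraicGeometry.Scheme.Modules

/-! ### Idempotent matrices over local rings -/

section Idempotent

/-- An idempotent matrix over a local ring is a product of a matrix with a left inverse of it. -/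
lemma Matrix.exists_splitting_of_isLocalRing {A : Type*} [CommRing A] [IsLocalRing A] {r : ℕ}
    (c : Matrix (Fin r) (Fin r) A) (hc : c * c = c) :
    ∃ (m : ℕ) (s : Matrix (Fin r) (Fin m) A) (t : Matrix (Fin m) (Fin r) A),
      t * s = 1 ∧ s * t = c := by
  let φ := Matrix.toLin' c
  have hφ : φ ∘ₗ φ = φ := by rw [← Matrix.toLin'_mul, hc]
  let P := LinearMap.range φ
  have hφP (x : P) : φ x = x := by
    obtain ⟨_, y, rfl⟩ := x
    exact congr($hφ y)
  have : Module.Projective A P := .of_split P.subtype φ.rangeRestrict <| by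
    ext1 x
    exact Subtype.ext (hφP x)
  -- The image of an idempotent is a summand of a finite free module, hence finite projective, hence
  -- free. In a basis of it, the inclusion and the projection give `s` and `t`.
  have : Module.Free A P := Module.free_of_flat_of_isLocalRing
  let b := Module.finBasis A P
  let e := b.equivFun
  refine ⟨_, LinearMap.toMatrix' (P.subtype ∘ₗ e.symm.toLinearMap),
    LinearMap.toMatrix' (e.toLinearMap ∘ₗ φ.rangeRestrict), ?_, ?_⟩
  · rw [← LinearMap.toMatrix'_comp, ← LinearMap.toMatrix'_id]
    refine congr_arg _ (LinearMap.ext fun x ↦ ?_)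
    have (y : P) : φ.rangeRestrict y = y := Subtype.ext (hφP y)
    simp [this]
  · rw [← LinearMap.toMatrix'_comp]
    conv_rhs => rw [← LinearMap.toMatrix'_toLin' c]
    refine congr_arg _ (LinearMap.ext fun x ↦ ?_)
    simp [φ]

end Idempotent

/-! ### Points of finitely generated subalgebras -/

section Specialization

variable {k K : Type*} [Field k] [IsAlgClosed k] [Field K] [Algebra k K]

/-- A finitely generated subalgebra of an extension of an algebraically closed field has a point,
and this point extends to a linear functional. -/
lemma exists_specialization (Z : Finset K) :
    ∃ (R : Subalgebra k K) (σ : R →ₐ[k] k) (l : K →ₗ[k] k), (Z : Set K) ⊆ R ∧ ∀ x : R, l x = σ x := by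
  let R := Algebra.adjoin k (Z : Set K)
  have : Algebra.FiniteType k R := (Subalgebra.fg_iff_finiteType _).mp ⟨Z, rfl⟩
  obtain ⟨m, hm⟩ := Ideal.exists_maximal R
  let := Ideal.Quotient.field m
  -- Nullstellensatz: the residue field is finite over `k`, hence equal to `k`.
  have : Module.Finite k (R ⧸ m) := finite_of_finite_type_of_isJacobsonRing k (R ⧸ m)
  let e : k ≃ₐ[k] R ⧸ m := AlgEquiv.ofBijective (Algebra.ofId k _)
    IsAlgClosed.algebraMap_bijective_of_isIntegral
  let σ : R →ₐ[k] k := e.symm.toAlgHom.comp (Ideal.Quotient.mkₐ k m)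
  obtain ⟨l, hl⟩ := LinearMap.exists_extend (p := Subalgebra.toSubmodule R) σ.toLinearMap
  exact ⟨R, σ, l, Algebra.subset_adjoin, fun x ↦ congr($hl x)⟩

end Specialization

/-! ### Functionals and specialization on tensor products -/

open TensorProduct

lemma exists_tensor_equiv_of_isPushout {k A K B : Type u} [CommRing k] [CommRing A] [CommRing K]
    [CommRing B] [Algebra k A] [Algebra k K] {a : A →+* B} {b : K →+* B}
    (h : IsPushout (CommRingCat.ofHom (algebraMap k A)) (CommRingCat.ofHom (algebraMap k K))
      (CommRingCat.ofHom a) (CommRingCat.ofHom b)) :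
    ∃ e : A ⊗[k] K ≃+* B, ∀ x z, e (x ⊗ₜ z) = a x * b z := by
  let i := (CommRingCat.isPushout_tensorProduct k A K).isoIsPushout _ _ h
  have h1 (x : A) : i.hom (x ⊗ₜ 1) = a x := congr($(IsPushout.inl_isoIsPushout_hom _ _
    (CommRingCat.isPushout_tensorProduct k A K) h).hom x)
  have h2 (z : K) : i.hom (1 ⊗ₜ z) = b z := congr($(IsPushout.inr_isoIsPushout_hom _ _
    (CommRingCat.isPushout_tensorProduct k A K) h).hom z)
  refine ⟨i.commRingCatIsoToRingEquiv, fun x z ↦ ?_⟩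
  rw [← h1, ← h2, ← map_mul, Algebra.TensorProduct.tmul_mul_tmul, mul_one, one_mul]
  rfl

section Tensor

variable {k A K B : Type*} [Field k] [CommRing A] [CommRing K] [CommRing B] [Algebra k A]
  [Algebra k K] {a : A →+* B} {b : K →+* B} (e : A ⊗[k] K ≃+* B)
  (he : ∀ x z, e (x ⊗ₜ z) = a x * b z)

/-- The `A`-linear extension of a linear functional to the base change of `A`. -/
def extendFunctional (l : K →ₗ[k] k) : B →+ A :=
  ((TensorProduct.rid k A).toLinearMap ∘ₗ l.lTensor A).toAddMonoidHom.comp e.symm.toAddMonoidHom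

include he in
lemma extendFunctional_mul (l : K →ₗ[k] k) (x : A) (z : K) :
    extendFunctional e l (a x * b z) = l z • x := by
  rw [← he]
  simp [extendFunctional]

include he in
lemma tensor_induction {p : B → Prop} (h0 : p 0) (hm : ∀ x z, p (a x * b z))
    (hadd : ∀ y y', p y → p y' → p (y + y')) (y : B) : p y := by
  obtain ⟨y, rfl⟩ := e.surjective y
  induction y with
  | zero => simpa
  | tmul x z => simpa [he] using hm x z
  | add y y' h h' => simpa using hadd _ _ h h'

include he in
lemma extendFunctional_smul (l : K →ₗ[k] k) (x : A) (y : B) :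
    extendFunctional e l (a x * y) = x * extendFunctional e l y := by
  induction y using tensor_induction e he with
  | h0 => simp
  | hm x' z =>
    rw [← mul_assoc, ← map_mul, extendFunctional_mul e he, extendFunctional_mul e he,
      mul_smul_comm]
  | hadd y y' h h' => simp [mul_add, h, h']

/-- The base change to a subalgebra, mapping to the full base change. -/
def fromSubalgebra (R : Subalgebra k K) : A ⊗[k] R →+* B :=
  e.toRingHom.comp (Algebra.TensorProduct.map (AlgHom.id k A) R.val).toRingHom

/-- The base change to a subalgebra, specialized at a point of this subalgebra. -/
def specialize {R : Subalgebra k K} (σ : R →ₐ[k] k) : A ⊗[k] R →+* A :=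
  (Algebra.TensorProduct.lift (AlgHom.id k A) ((Algebra.ofId k A).comp σ)
    fun _ _ ↦ Commute.all _ _).toRingHom

/-- `extendFunctional` is merely additive, whereas `specialize` is a ring homomorphism. Their
agreement on `A ⊗ R` makes the functional multiplicative where it matters. -/
lemma extendFunctional_fromSubalgebra {R : Subalgebra k K} (σ : R →ₐ[k] k) (l : K →ₗ[k] k)
    (hl : ∀ x : R, l x = σ x) (y : A ⊗[k] R) :
    extendFunctional e l (fromSubalgebra e R y) = specialize σ y := by
  induction y with
  | zero => simp
  | tmul x z =>
    simp [extendFunctional, fromSubalgebra, specialize, hl, Algebra.smul_def, mul_comm,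
      Algebra.ofId_apply]
  | add y y' h h' => simp [h, h']

lemma exists_finset_mem_range (y : B) : ∃ Z : Finset K, ∀ R : Subalgebra k K, (Z : Set K) ⊆ R →
    y ∈ (fromSubalgebra (A := A) e R).range := by
  classical
  obtain ⟨y, rfl⟩ := e.surjective y
  induction y with
  | zero => exact ⟨∅, fun R _ ↦ by simp⟩
  | tmul x z =>
    refine ⟨{z}, fun R hR ↦ ⟨x ⊗ₜ ⟨z, by simpa using hR⟩, ?_⟩⟩
    simp [fromSubalgebra]
  | add y y' h h' =>
    obtain ⟨Z, hZ⟩ := h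
    obtain ⟨Z', hZ'⟩ := h'
    refine ⟨Z ∪ Z', fun R hR ↦ ?_⟩
    rw [Finset.coe_union, Set.union_subset_iff] at hR
    rw [map_add]
    exact add_mem (hZ R hR.1) (hZ' R hR.2)

lemma exists_finset_matrix_mem_range {ι : Type*} [Finite ι] (c : Matrix ι ι B) :
    ∃ Z : Finset K, ∀ R : Subalgebra k K, (Z : Set K) ⊆ R →
      ∃ c' : Matrix ι ι (A ⊗[k] R), c'.map (fromSubalgebra e R) = c := by
  classical
  have := Fintype.ofFinite ι
  choose Z hZ using fun i j ↦ exists_finset_mem_range (k := k) (A := A) e (c i j)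
  refine ⟨Finset.univ.biUnion fun i ↦ Finset.univ.biUnion fun j ↦ Z i j, fun R hR ↦ ?_⟩
  choose c' hc' using fun i j ↦ hZ i j R ((Finset.coe_subset.mpr
    ((Finset.subset_biUnion_of_mem (Z i) (Finset.mem_univ j)).trans
      (Finset.subset_biUnion_of_mem (fun i ↦ Finset.univ.biUnion fun j ↦ Z i j)
        (Finset.mem_univ i)))).trans hR)
  exact ⟨Matrix.of c', Matrix.ext hc'⟩

section Specialize

variable {ι : Type*} {R : Subalgebra k K} (σ : R →ₐ[k] k)
  (l : K →ₗ[k] k) (hl : ∀ x : R, l x = σ x) (c : Matrix ι ι B) (c' : Matrix ι ι (A ⊗[k] R))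
  (hc' : c'.map (fromSubalgebra e R) = c)
include hl hc'

lemma map_extendFunctional : c.map (extendFunctional e l) = c'.map (specialize σ) := by
  rw [← hc']
  ext i j
  exact extendFunctional_fromSubalgebra e σ l hl _

variable [Fintype ι] in
lemma map_extendFunctional_idem (hc : c * c = c) :
    c.map (extendFunctional e l) * c.map (extendFunctional e l) = c.map (extendFunctional e l) := by
  -- The lift `c'` need not be known to be idempotent: `c' * c'` is another lift of `c * c = c`, and
  -- the functional computes the specialization of either lift.
  have h := map_extendFunctional e σ l hl (c * c) (c' * c') (by rw [Matrix.map_mul, hc'])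
  rw [hc, map_extendFunctional e σ l hl c c' hc', Matrix.map_mul] at h
  rw [map_extendFunctional e σ l hl c c' hc']
  exact h.symm

-- Specialization at `σ` sends both `c` and `d` to the idempotent `D`, and `D * D + (1 - D) * (1 -
-- D) = 1`. A vanishing power of the determinant would thus give `1 = 0` in `A`.
include he in
variable [Fintype ι] [DecidableEq ι] in
lemma not_isNilpotent_det [Nontrivial A] (hc : c * c = c) (d : Matrix ι ι B)
    (hd : d = (c.map (extendFunctional e l)).map a) :
    ¬ IsNilpotent (c * d + (1 - c) * (1 - d)).det := by
  rintro ⟨n, hn⟩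
  let D := c.map (extendFunctional e l)
  let ι' : A →+* A ⊗[k] R := Algebra.TensorProduct.includeLeftRingHom
  have h1 : (D.map ι').map (fromSubalgebra e R) = d := by
    rw [hd, Matrix.map_map]
    congr 1
    ext x
    simp [ι', fromSubalgebra, he]
  have h2 : (D.map ι').map (specialize σ) = D := by
    rw [Matrix.map_map]
    ext i j
    simp [ι', specialize]
  let u' := c' * D.map ι' + (1 - c') * (1 - D.map ι')
  have h3 : (fromSubalgebra e R).mapMatrix u' = c * d + (1 - c) * (1 - d) := by
    simp only [u', map_add, map_mul, map_sub, map_one, RingHom.mapMatrix_apply, h1, hc']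
  have h4 : (specialize σ).mapMatrix u' = 1 := by
    simp only [u', map_add, map_mul, map_sub, map_one, RingHom.mapMatrix_apply, h2,
      ← map_extendFunctional e σ l hl c c' hc']
    have hD : D * D = D := map_extendFunctional_idem e σ l hl c c' hc' hc
    change D * D + (1 - D) * (1 - D) = 1
    rw [mul_sub, sub_mul, sub_mul, hD]
    simp
  rw [← h3, ← RingHom.map_det, ← map_pow] at hn
  -- Applying the functional in `B`, rather than `specialize` upstairs, avoids needing injectivity
  -- of `A ⊗ R → B`.
  have h5 := congr(extendFunctional e l $hn)
  rw [extendFunctional_fromSubalgebra e σ l hl, map_zero, map_pow, RingHom.map_det, h4,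
    Matrix.det_one, one_pow] at h5
  exact one_ne_zero h5

end Specialize

end Tensor

/-! ### Summands of locally free modules are locally free -/

namespace AlgebraicGeometry.Scheme.Modules

open TopologicalSpace Limits

variable {X Y : Scheme.{u}} {E F G : X.Modules} {U V W : X.Opens}

lemma germ_resFun (h : V ≤ U) (x : X) (hx : x ∈ V) (a : Γ(X, U)) :
    (X.presheaf.germ V x hx).hom (resFun h a) = (X.presheaf.germ U x (h hx)).hom a :=
  congr($(X.presheaf.germ_res (homOfLE h) x hx).hom a)

/-- An intersection of finitely many open neighbourhoods inside a given one. -/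
def infOpens {ι : Type*} [Fintype ι] (U : X.Opens) (V : ι → X.Opens) : X.Opens :=
  U ⊓ Finset.univ.inf V

lemma infOpens_le_left {ι : Type*} [Fintype ι] (U : X.Opens) (V : ι → X.Opens) :
    infOpens U V ≤ U := inf_le_left

lemma infOpens_le {ι : Type*} [Fintype ι] (U : X.Opens) (V : ι → X.Opens) (i : ι) :
    infOpens U V ≤ V i := inf_le_right.trans (Finset.inf_le (Finset.mem_univ i))

lemma mem_infOpens {ι : Type*} [Fintype ι] {U : X.Opens} {V : ι → X.Opens} {x : X} (hx : x ∈ U)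
    (h : ∀ i, x ∈ V i) : x ∈ infOpens U V := by
  refine ⟨hx, ?_⟩
  rw [SetLike.mem_coe, ← SetLike.mem_coe, Opens.coe_finset_inf]
  simpa using h

lemma exists_lift_germs {ι : Type*} [Fintype ι] {x : X} (hx : x ∈ U)
    (a : ι → X.presheaf.stalk x) : ∃ (V : X.Opens) (_ : V ≤ U) (hxV : x ∈ V) (b : ι → Γ(X, V)),
      ∀ i, (X.presheaf.germ V x hxV).hom (b i) = a i := by
  choose V hV b hb using fun i ↦ X.presheaf.exists_germ_eq (a i)
  exact ⟨infOpens U V, infOpens_le_left _ _, mem_infOpens hx hV,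
    fun i ↦ resFun (infOpens_le U V i) (b i), fun i ↦ (germ_resFun _ _ _ _).trans (hb i)⟩

lemma exists_eq_of_germs_eq {ι : Type*} [Fintype ι] {x : X} (hx : x ∈ U) (a b : ι → Γ(X, U))
    (h : ∀ i, (X.presheaf.germ U x hx).hom (a i) = (X.presheaf.germ U x hx).hom (b i)) :
    ∃ (V : X.Opens) (hV : V ≤ U), x ∈ V ∧ ∀ i, resFun hV (a i) = resFun hV (b i) := by
  choose V hxV iU iU' hab using fun i ↦ X.presheaf.germ_eq x hx hx (a i) (b i) (h i)
  refine ⟨infOpens U V, infOpens_le_left _ _, mem_infOpens hx hxV, fun i ↦ ?_⟩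
  have := congr(resFun (infOpens_le U V i) $(hab i))
  exact (resFun_resFun (leOfHom (iU i)) _ _).symm.trans
    (this.trans (resFun_resFun (leOfHom (iU i)) _ _))

/-- Split over the local ring at `x`. The splitting involves finitely many germs and finitely many
equations, so it persists on a neighbourhood. -/
lemma exists_matrix_splitting {r : ℕ} (c : Matrix (Fin r) (Fin r) Γ(X, U)) (hc : c * c = c)
    {x : X} (hx : x ∈ U) : ∃ (V : X.Opens) (hV : V ≤ U) (_ : x ∈ V) (m : ℕ)
      (s : Matrix (Fin r) (Fin m) Γ(X, V)) (t : Matrix (Fin m) (Fin r) Γ(X, V)),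
      t * s = 1 ∧ s * t = c.map (resFun hV) := by
  let g := (X.presheaf.germ U x hx).hom
  obtain ⟨m, s, t, hts, hst⟩ := Matrix.exists_splitting_of_isLocalRing (c.map g)
    (by rw [← Matrix.map_mul, hc])
  obtain ⟨V, hV, hxV, b, hb⟩ := exists_lift_germs hx
    (Sum.elim (fun ij : Fin r × Fin m ↦ s ij.1 ij.2) (fun ij : Fin m × Fin r ↦ t ij.1 ij.2))
  let s' : Matrix (Fin r) (Fin m) Γ(X, V) := .of fun i j ↦ b (.inl (i, j))
  let t' : Matrix (Fin m) (Fin r) Γ(X, V) := .of fun i j ↦ b (.inr (i, j))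
  let g' := (X.presheaf.germ V x hxV).hom
  have hs' : s'.map g' = s := Matrix.ext fun i j ↦ hb (.inl (i, j))
  have ht' : t'.map g' = t := Matrix.ext fun i j ↦ hb (.inr (i, j))
  have h1 : (t' * s').map g' = (1 : Matrix (Fin m) (Fin m) Γ(X, V)).map g' := by
    rw [Matrix.map_mul, hs', ht', hts, Matrix.map_one _ (map_zero _) (map_one _)]
  have h2 : (s' * t').map g' = (c.map (resFun hV)).map g' := by
    rw [Matrix.map_mul, hs', ht', hst]
    ext i j
    exact (germ_resFun hV x hxV _).symm
  obtain ⟨W, hW, hxW, h⟩ := exists_eq_of_germs_eq hxV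
    (Sum.elim (fun ij : Fin m × Fin m ↦ (t' * s') ij.1 ij.2)
      (fun ij : Fin r × Fin r ↦ (s' * t') ij.1 ij.2))
    (Sum.elim (fun ij : Fin m × Fin m ↦ (1 : Matrix (Fin m) (Fin m) Γ(X, V)) ij.1 ij.2)
      (fun ij : Fin r × Fin r ↦ (c.map (resFun hV)) ij.1 ij.2))
    (by
      rintro (⟨i, j⟩ | ⟨i, j⟩)
      · exact congr($h1 i j)
      · exact congr($h2 i j))
  refine ⟨W, hW.trans hV, hxW, m, s'.map (resFun hW), t'.map (resFun hW), ?_, ?_⟩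
  · rw [← Matrix.map_mul, ← Matrix.map_one (resFun hW) (map_zero _) (map_one _)]
    exact Matrix.ext fun i j ↦ h (.inl (i, j))
  · rw [← Matrix.map_mul]
    ext i j
    exact (h (.inr (i, j))).trans (resFun_resFun _ _ _)

section Splitting

variable {V₀ : X.Modules} {i₀ : V₀ ⟶ E} {q₀ : E ⟶ V₀} (h₁ : i₀ ≫ q₀ = 𝟙 V₀)
include h₁

/-- Since `b * a = 1`, the columns of `a` are a basis of the image of the idempotent matrix `a * b`,
which `i₀` identifies with `V₀`. -/
lemma IsFrame.exists_isFrame_of_splitting {r m : ℕ} {s : Fin r → Γ(E, U)} (hs : IsFrame E U s)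
    (a : Matrix (Fin r) (Fin m) Γ(X, U)) (b : Matrix (Fin m) (Fin r) Γ(X, U)) (hba : b * a = 1)
    (hab : ∀ j, (q₀ ≫ i₀).appLin U (s j) = ∑ i, (a * b) i j • s i) :
    IsFrame V₀ U fun j ↦ q₀.appLin U (∑ i, a i j • s i) := by
  intro W hW
  have hsW := hs W hW
  let A := a.map (resFun hW)
  let B := b.map (resFun hW)
  have hBA : B * A = 1 := by
    rw [← Matrix.map_mul, hba, Matrix.map_one _ (map_zero _) (map_one _)]
  let S (c : Fin r → Γ(X, W)) : Γ(E, W) := ∑ i, c i • E.res hW (s i)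
  have hS (c : Fin m → Γ(X, W)) : ∑ j, c j • V₀.res hW (q₀.appLin U (∑ i, a i j • s i)) =
      q₀.appLin W (S (A.mulVec c)) := by
    simp only [← appLin_res, map_sum, res_smul, S, ← LinearMap.map_smul, Finset.smul_sum,
      Matrix.mulVec, dotProduct, Finset.sum_smul, smul_smul]
    rw [Finset.sum_comm]
    simp [A, mul_comm]
  have he (c : Fin r → Γ(X, W)) : i₀.appLin W (q₀.appLin W (S c)) = S ((A * B).mulVec c) := by
    have hj (j : Fin r) : i₀.appLin W (q₀.appLin W (E.res hW (s j))) =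
        ∑ i, (A * B) i j • E.res hW (s i) := by
      have := congr(E.res hW $(hab j))
      rw [← appLin_res, appLin_comp] at this
      simp only [LinearMap.comp_apply] at this
      rw [this, map_sum]
      simp only [res_smul, A, B, ← Matrix.map_mul]
      rfl
    simp only [S, map_sum, LinearMap.map_smul, hj, Matrix.mulVec, dotProduct, Finset.sum_smul,
      Finset.smul_sum, smul_smul]
    rw [Finset.sum_comm]
    simp [mul_comm]
  have hid (x : Γ(V₀, W)) : q₀.appLin W (i₀.appLin W x) = x := congr(($h₁).appLin W x)
  have hinj : Function.Injective (i₀.appLin W) := Function.LeftInverse.injective hid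
  simp only [hS]
  constructor
  · intro c c' hcc'
    have := congr(i₀.appLin W $hcc')
    simp only [he] at this
    have := congr(B.mulVec $(hsW.1 this))
    simpa [Matrix.mulVec_mulVec, hBA, Matrix.mul_assoc] using this
  · intro x
    obtain ⟨c, hc⟩ := hsW.2 (i₀.appLin W x)
    -- If `c` are the coordinates of `i₀ x`, then `B c` are those of `x`, because `q₀ ≫ i₀` fixes
    -- `i₀ x`.
    refine ⟨B.mulVec c, hinj ?_⟩
    change S c = _ at hc
    have := he c
    rw [hc, hid] at this
    change i₀.appLin W (q₀.appLin W _) = _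
    rw [he, this]
    simp only [Matrix.mulVec_mulVec]
    rw [Matrix.mul_assoc, ← Matrix.mul_assoc B, hBA, Matrix.one_mul]

lemma IsFrame.exists_isFrame_summand {r : ℕ} {s : Fin r → Γ(E, U)} (hs : IsFrame E U s) {x : X}
    (hx : x ∈ U) : ∃ V : X.Opens, x ∈ V ∧ ∃ (m : ℕ) (t : Fin m → Γ(V₀, V)), IsFrame V₀ V t := by
  let e := q₀ ≫ i₀
  have he : e ≫ e = e := by simp [e, reassoc_of% h₁]
  obtain ⟨V, hV, hxV, m, a, b, hba, hab⟩ := exists_matrix_splitting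
    (LinearMap.toMatrix hs.basis hs.basis (e.appLin U))
    (by rw [← LinearMap.toMatrix_comp, ← appLin_comp, he]) hx
  refine ⟨V, hxV, m, _, (hs.mono hV).exists_isFrame_of_splitting h₁ a b hba fun j ↦ ?_⟩
  rw [hab, ← hs.appLin_eq_toMatrix, ← (hs.mono hV).basis.sum_repr ((q₀ ≫ i₀).appLin V _)]
  simp [LinearMap.toMatrix_apply, e]

end Splitting

end AlgebraicGeometry.Scheme.Modules

/-! ### Properness of projective curves -/

instance isProper_projectiveSpaceToSpec (K : Type) [Field K] (n : ℕ) :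
    IsProper (projectiveSpaceToSpec K n) := by
  let := MvPolynomial.gradedAlgebra (σ := Fin (n + 1)) (R := K)
  have : IsScalarTower K (MvPolynomial.homogeneousSubmodule (Fin (n + 1)) K 0)
    (MvPolynomial (Fin (n + 1)) K) :=
    ⟨fun a b c ↦ smul_mul_assoc a (b : MvPolynomial (Fin (n + 1)) K) c⟩
  have : Algebra.FiniteType (MvPolynomial.homogeneousSubmodule (Fin (n + 1)) K 0)
    (MvPolynomial (Fin (n + 1)) K) := .of_restrictScalars_finiteType K _ _
  -- The degree zero part is the field of constants, so the structure morphism is `Proj.toSpecZero`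
  -- followed by an isomorphism.
  have hbij : Function.Bijective
      (algebraMap K (MvPolynomial.homogeneousSubmodule (Fin (n + 1)) K 0)) := by
    refine ⟨fun a b h ↦ MvPolynomial.C_injective (Fin (n + 1)) K congr(($h).1),
      fun ⟨x, hx⟩ ↦ ⟨MvPolynomial.coeff 0 x, Subtype.ext ?_⟩⟩
    have := (MvPolynomial.totalDegree_zero_iff_isHomogeneous _).mpr hx
    exact (MvPolynomial.totalDegree_eq_zero_iff_eq_C.mp this).symm
  have : IsIso (CommRingCat.ofHom
      (algebraMap K (MvPolynomial.homogeneousSubmodule (Fin (n + 1)) K 0))) :=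
    (ConcreteCategory.isIso_iff_bijective _).mpr hbij
  exact inferInstanceAs (IsProper (Proj.toSpecZero _ ≫ Spec.map _))

lemma IsSmoothProjectiveCurve.isProper {K : Type} [Field K] {X : Scheme.{0}}
    {p : X ⟶ Spec (CommRingCat.of K)} (h : IsSmoothProjectiveCurve p) : IsProper p := by
  obtain ⟨n, i, _, rfl⟩ := h.projective
  infer_instance

/-! ### Global functions on proper irreducible schemes -/

namespace AlgebraicGeometry.Scheme

section GlobalFunctions

variable {X : Scheme.{u}} {k : Type u} [Field k]

/-- The constants of a scheme over a field. -/
def constants (p : X ⟶ Spec (CommRingCat.of k)) (U : X.Opens) : k →+* Γ(X, U) :=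
  ((ΓSpecIso (CommRingCat.of k)).inv ≫ p.appLE ⊤ U (by simp)).hom

lemma constants_res (p : X ⟶ Spec (CommRingCat.of k)) {U V : X.Opens} (h : V ≤ U) (z : k) :
    Modules.resFun h (constants p U z) = constants p V z := by
  have := p.appLE_map (U := ⊤) (V := U) le_top (homOfLE h).op
  exact congr($(this).hom _)

/-- On an irreducible scheme that is proper over an algebraically closed field, every function is
a constant up to a nilpotent. -/
lemma exists_isNilpotent_sub_constants [IsAlgClosed k] [IrreducibleSpace X]
    (p : X ⟶ Spec (CommRingCat.of k)) [UniversallyClosed p] [CompactSpace X] (x : Γ(X, ⊤)) :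
    ∃ c : k, IsNilpotent (x - constants p ⊤ c) := by
  have hint : (constants p ⊤).IsIntegral := by
    have h1 := isIntegral_appTop_of_universallyClosed p
    have h2 : (ΓSpecIso (CommRingCat.of k)).inv.hom.IsIntegral :=
      RingHom.isIntegral_of_surjective _
        (ConcreteCategory.bijective_of_isIso (ΓSpecIso (CommRingCat.of k)).inv).2
    have h3 := RingHom.IsIntegral.trans _ _ h2 h1
    convert h3 using 1
    rw [constants, CommRingCat.hom_comp]
    exact congr(RingHom.comp (CommRingCat.Hom.hom $(p.appLE_eq_app (U := ⊤))) _)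
  -- By compactness a function is nilpotent exactly when its basic open is empty, and nonempty opens
  -- of an irreducible space meet.
  have hprime : (_root_.nilradical Γ(X, ⊤)).IsPrime := by
    refine ⟨fun h ↦ ?_, fun {a b} hab ↦ ?_⟩
    · have : IsNilpotent (1 : Γ(X, ⊤)) := (Ideal.eq_top_iff_one _).mp h
      rw [isNilpotent_iff_basicOpen_eq_bot, basicOpen_one] at this
      obtain ⟨y⟩ : Nonempty X := inferInstance
      exact (congr(y ∈ $this) : (y ∈ (⊤ : X.Opens)) = _).mp trivial
    · simp only [mem_nilradical, isNilpotent_iff_basicOpen_eq_bot, basicOpen_mul] at hab ⊢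
      by_contra! h
      obtain ⟨y, hy⟩ := nonempty_preirreducible_inter (X.basicOpen a).2 (X.basicOpen b).2
        ((X.basicOpen a).ne_bot_iff_nonempty.mp h.1) ((X.basicOpen b).ne_bot_iff_nonempty.mp h.2)
      exact (congr(y ∈ $hab) : (y ∈ X.basicOpen a ⊓ X.basicOpen b) = _).mp hy
  obtain ⟨P, hP, hPx⟩ := hint x
  -- A monic equation for `x` splits over `k`, so a product of differences `x - c` vanishes and one
  -- of them lies in the prime nilradical.
  have hmem : (P.roots.map fun c ↦ x - constants p ⊤ c).prod ∈ _root_.nilradical Γ(X, ⊤) := by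
    rw [(IsAlgClosed.splits P).eq_prod_roots_of_monic hP] at hPx
    rw [Polynomial.eval₂_multiset_prod, Multiset.map_map] at hPx
    simp only [Function.comp_def, Polynomial.eval₂_sub, Polynomial.eval₂_X,
      Polynomial.eval₂_C] at hPx
    rw [hPx]
    exact zero_mem _
  obtain ⟨y, hy, hy'⟩ := (hprime.multiset_prod_mem_iff_exists_mem _).mp hmem
  obtain ⟨c, -, rfl⟩ := Multiset.mem_map.mp hy
  exact ⟨c, hy'⟩

end GlobalFunctions

end AlgebraicGeometry.Scheme

/-! ### Functions after extension of the base field -/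

namespace AlgebraicGeometry.Scheme

open TopologicalSpace Limits TensorProduct

section FieldExtension

variable {X : Scheme.{u}} {k K : Type u} [Field k] [Field K] [Algebra k K]
  (p : X ⟶ Spec (CommRingCat.of k))

/-- The functions on an open subset of a scheme over a field, as an algebra. -/
abbrev constantsAlgebra (U : X.Opens) : Algebra k Γ(X, U) := (constants p U).toAlgebra

/-- The base change along a field extension. -/
abbrev baseChange (K : Type u) [Field K] [Algebra k K] : Scheme.{u} :=
  Limits.pullback p (Spec.map (CommRingCat.ofHom (algebraMap k K)))

/-- The projection from the base change along a field extension. -/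
abbrev baseChangeProj (K : Type u) [Field K] [Algebra k K] : baseChange p K ⟶ X :=
  pullback.fst p (Spec.map (CommRingCat.ofHom (algebraMap k K)))

/-- The scalars on the base change along a field extension. -/
abbrev scalars (K : Type u) [Field K] [Algebra k K] (U : X.Opens) :
    K →+* Γ(baseChange p K, baseChangeProj p K ⁻¹ᵁ U) :=
  constants (pullback.snd p (Spec.map (CommRingCat.ofHom (algebraMap k K)))) _

/-- Flat base change for sections. It is stated for quasi-compact quasi-separated opens to cover the
whole proper scheme as well as affine charts. -/
lemma exists_tensor_equiv_sections {U : X.Opens} (hU : IsCompact (U : Set X))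
    (hU' : IsQuasiSeparated (U : Set X)) :
    letI := constantsAlgebra p U
    ∃ e : Γ(X, U) ⊗[k] K ≃+* Γ(baseChange p K, baseChangeProj p K ⁻¹ᵁ U), ∀ x z,
      e (x ⊗ₜ z) = Modules.pullbackFun (baseChangeProj p K) U x * scalars p K U z := by
  let := constantsAlgebra p U
  let g := Spec.map (CommRingCat.ofHom (algebraMap k K))
  have : Flat g := by
    rw [Flat.SpecMap_iff]
    exact RingHom.flat_algebraMap_iff.mpr inferInstance
  have H := IsPullback.of_hasPullback p g
  have hUY : baseChangeProj p K ⁻¹ᵁ U =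
    baseChangeProj p K ⁻¹ᵁ U ⊓ (pullback.snd p g) ⁻¹ᵁ ⊤ := by simp
  have h1 := isIso_pushoutSection_of_isQuasiSeparated_of_flat_right H (US := ⊤) (UT := ⊤)
    (show (⊤ : (Spec _).Opens) ≤ g ⁻¹ᵁ ⊤ from le_top) (show U ≤ p ⁻¹ᵁ ⊤ from le_top) hUY
    (isAffineOpen_top _) (isAffineOpen_top _) hU hU'
  replace h1 := (isIso_pushoutSection_iff _ _ _ _).mp h1
  refine exists_tensor_equiv_of_isPushout ?_
  refine h1.of_iso (ΓSpecIso (.of k)) (Iso.refl _) (ΓSpecIso (.of K)) (Iso.refl _) ?_ ?_ ?_ ?_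
  · exact (Category.comp_id _).trans (Iso.hom_inv_id_assoc _ _).symm
  · refine Eq.trans ?_ (ΓSpecIso_naturality (CommRingCat.ofHom (algebraMap k K)))
    exact congr($(g.appLE_eq_app (U := ⊤)) ≫ _)
  · exact (Category.comp_id _).trans
      (((pullback.fst p g).appLE_eq_app (U := U)).trans (Category.id_comp _).symm)
  · exact (Category.comp_id _).trans (Iso.hom_inv_id_assoc _ _).symm

lemma scalars_res {U V : X.Opens} (h : V ≤ U) (z : K) :
    Modules.resFun ((baseChangeProj p K).preimage_mono h) (scalars p K U z) = scalars p K V z :=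
  constants_res _ _ z

/-- On the base change of a proper irreducible scheme over an algebraically closed field along a
field extension, every function is a scalar up to a nilpotent. -/
lemma exists_isNilpotent_sub_scalars [IsAlgClosed k] [IrreducibleSpace X] [IsProper p]
    (d : Γ(baseChange p K, baseChangeProj p K ⁻¹ᵁ ⊤)) :
    ∃ z : K, IsNilpotent (d - scalars p K ⊤ z) := by
  have : CompactSpace X := (quasiCompact_iff_compactSpace p).mp inferInstance
  have : QuasiSeparatedSpace X := (quasiSeparated_iff_quasiSeparatedSpace p).mp inferInstance
  let := constantsAlgebra p ⊤
  obtain ⟨e, he⟩ := exists_tensor_equiv_sections (K := K) p (U := ⊤) isCompact_univ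
    (isQuasiSeparated_univ_iff.mpr inferInstance)
  have hc (c : k) : Modules.pullbackFun (baseChangeProj p K) ⊤ (constants p ⊤ c) =
      scalars p K ⊤ (algebraMap k K c) := by
    have h1 := he (algebraMap k _ c) 1
    rwa [Algebra.algebraMap_eq_smul_one, TensorProduct.smul_tmul, he, map_one, one_mul, map_one,
      mul_one, ← Algebra.algebraMap_eq_smul_one, ← Algebra.algebraMap_eq_smul_one, eq_comm] at h1
  induction d using tensor_induction e he with
  | h0 => exact ⟨0, by rw [map_zero, sub_zero]; exact IsNilpotent.zero⟩
  | hm x z =>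
    obtain ⟨c, hcx⟩ := exists_isNilpotent_sub_constants p x
    refine ⟨algebraMap k K c * z, ?_⟩
    have : Modules.pullbackFun (baseChangeProj p K) ⊤ x * scalars p K ⊤ z -
        scalars p K ⊤ (algebraMap k K c * z) =
        Modules.pullbackFun (baseChangeProj p K) ⊤ (x - constants p ⊤ c) * scalars p K ⊤ z := by
      rw [map_sub, hc, map_mul, sub_mul]
    rw [this]
    exact (Commute.all _ _).isNilpotent_mul_right (hcx.map _)
  | hadd y y' h h' =>
    obtain ⟨c, hc⟩ := h
    obtain ⟨c', hc'⟩ := h'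
    refine ⟨c + c', ?_⟩
    rw [map_add, add_sub_add_comm]
    exact (Commute.all _ _).isNilpotent_add hc hc'

/-- A nonzero scalar is a unit and stays one after adding a nilpotent. -/
lemma isNilpotent_or_isUnit [IsAlgClosed k] [IrreducibleSpace X] [IsProper p]
    (d : Γ(baseChange p K, ⊤)) : IsNilpotent d ∨ IsUnit d := by
  suffices ∀ d : Γ(baseChange p K, baseChangeProj p K ⁻¹ᵁ ⊤), IsNilpotent d ∨ IsUnit d from this d
  intro d
  obtain ⟨z, hz⟩ := exists_isNilpotent_sub_scalars p d
  obtain rfl | hz0 := eq_or_ne z 0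
  · rw [map_zero, sub_zero] at hz
    exact .inl hz
  · have h1 : IsUnit (scalars p K ⊤ z) := (IsUnit.mk0 z hz0).map _
    have h2 := hz.isUnit_add_left_of_commute h1 (Commute.all _ _)
    rw [add_sub_cancel] at h2
    exact .inr h2

end FieldExtension

end AlgebraicGeometry.Scheme

/-! ### Applying a functional to sections and endomorphisms -/

namespace AlgebraicGeometry.Scheme

open TopologicalSpace TensorProduct

open Modules

section

variable {X : Scheme.{0}} {E F : X.Modules} {U V : X.Opens}

lemma Modules.IsFrame.appLin_eq {ι : Type*} [Fintype ι] {s : ι → Γ(E, U)} (hs : IsFrame E U s)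
    {φ ψ : E ⟶ F} (h : φ.appLin U = ψ.appLin U) (hV : V ≤ U) : φ.appLin V = ψ.appLin V := by
  refine (hs.mono hV).basis.ext fun i ↦ ?_
  rw [IsFrame.basis_apply, appLin_res, appLin_res, h]

lemma exists_affine_frame (hE : ∀ x : X, ∃ U : X.Opens, x ∈ U ∧ ∃ (r : ℕ) (s : Fin r → Γ(E, U)),
    IsFrame E U s) : Opens.IsBasis (Set.range fun W : {W : X.Opens // IsAffineOpen W ∧
      ∃ (r : ℕ) (s : Fin r → Γ(E, W)), IsFrame E W s} ↦ W.1) := by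
  rw [Opens.isBasis_iff_nbhd]
  intro U x hx
  obtain ⟨V, hxV, r, s, hs⟩ := hE x
  obtain ⟨W, hW, hxW, hWU⟩ := Opens.isBasis_iff_nbhd.mp X.isBasis_affineOpens
    (show x ∈ U ⊓ V from ⟨hx, hxV⟩)
  exact ⟨W, ⟨⟨W, hW, r, _, hs.mono (hWU.trans inf_le_right)⟩, rfl⟩, hxW, hWU.trans inf_le_left⟩

end

section Functional

variable {X : Scheme.{0}} {k K : Type} [Field k] [Field K] [Algebra k K]
  (p : X ⟶ Spec (CommRingCat.of k)) {U V : X.Opens}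

lemma exists_tensor_equiv_sections_of_isAffineOpen (hU : IsAffineOpen U) :
    letI := constantsAlgebra p U
    ∃ e : Γ(X, U) ⊗[k] K ≃+* Γ(baseChange p K, baseChangeProj p K ⁻¹ᵁ U), ∀ x z,
      e (x ⊗ₜ z) = Modules.pullbackFun (baseChangeProj p K) U x * scalars p K U z :=
  exists_tensor_equiv_sections p hU.isCompact hU.isQuasiSeparated

/-- Functions on the base change of an affine open subset, as a tensor product. -/
def tensorEquiv (K : Type) [Field K] [Algebra k K] (hU : IsAffineOpen U) :
    letI := constantsAlgebra p U
    Γ(X, U) ⊗[k] K ≃+* Γ(baseChange p K, baseChangeProj p K ⁻¹ᵁ U) :=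
  (exists_tensor_equiv_sections_of_isAffineOpen p hU).choose

lemma tensorEquiv_tmul (hU : IsAffineOpen U) (x : Γ(X, U)) (z : K) :
    letI := constantsAlgebra p U
    tensorEquiv p K hU (x ⊗ₜ z) =
      Modules.pullbackFun (baseChangeProj p K) U x * scalars p K U z :=
  (exists_tensor_equiv_sections_of_isAffineOpen p hU).choose_spec x z

/-- The extension of a functional on the scalars to the functions on the base change of an affine
open subset. -/
def functional (l : K →ₗ[k] k) (hU : IsAffineOpen U) :
    Γ(baseChange p K, baseChangeProj p K ⁻¹ᵁ U) →+ Γ(X, U) :=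
  letI := constantsAlgebra p U
  extendFunctional (tensorEquiv p K hU) l

lemma functional_smul (l : K →ₗ[k] k) (hU : IsAffineOpen U) (x : Γ(X, U))
    (y : Γ(baseChange p K, baseChangeProj p K ⁻¹ᵁ U)) :
    functional p l hU (pullbackFun (baseChangeProj p K) U x * y) = x * functional p l hU y :=
  let := constantsAlgebra p U
  extendFunctional_smul (tensorEquiv p K hU) (tensorEquiv_tmul p hU) l x y

lemma functional_res (l : K →ₗ[k] k) (hU : IsAffineOpen U) (hV : IsAffineOpen V) (h : V ≤ U)
    (y : Γ(baseChange p K, baseChangeProj p K ⁻¹ᵁ U)) :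
    functional p l hV (resFun ((baseChangeProj p K).preimage_mono h) y) =
      resFun h (functional p l hU y) := by
  let := constantsAlgebra p U
  let := constantsAlgebra p V
  induction y using tensor_induction _ (tensorEquiv_tmul p hU) with
  | h0 => simp
  | hm x z =>
    rw [map_mul, scalars_res p h, ← pullbackFun_res _ h, functional, functional,
      extendFunctional_mul _ (tensorEquiv_tmul p hU), extendFunctional_mul _ (tensorEquiv_tmul p hV),
      Algebra.smul_def, Algebra.smul_def, map_mul]
    exact congrArg (· * resFun h x) (constants_res p h (l z)).symm
  | hadd y y' hy hy' => simp only [map_add, hy, hy']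

variable {E : X.Modules}

/-- The extension of a functional on the scalars to the sections of a base change over an affine
open subset with a frame. -/
def secFunctional {r : ℕ} {s : Fin r → Γ(E, U)} (l : K →ₗ[k] k) (hU : IsAffineOpen U)
    (hs : IsFrame E U s) :
    Γ((pullback (baseChangeProj p K)).obj E, baseChangeProj p K ⁻¹ᵁ U) →+ Γ(E, U) where
  toFun y := ∑ i, functional p l hU ((hs.pullback (baseChangeProj p K)).basis.repr y i) • s i
  map_zero' := by simp
  map_add' y y' := by simp [add_smul, Finset.sum_add_distrib]

variable {r r' : ℕ} {s : Fin r → Γ(E, U)} (l : K →ₗ[k] k) (hU : IsAffineOpen U)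
    (hs : IsFrame E U s) (hV : IsAffineOpen V) {t : Fin r' → Γ(E, V)} (ht : IsFrame E V t)

lemma secFunctional_smul_frame (c : Γ(baseChange p K, baseChangeProj p K ⁻¹ᵁ U)) (i : Fin r) :
    secFunctional p l hU hs (c • pullbackSec (baseChangeProj p K) E U (s i)) =
      functional p l hU c • s i := by
  classical
  have h : (hs.pullback (baseChangeProj p K)).basis.repr
      (c • pullbackSec (baseChangeProj p K) E U (s i)) = Finsupp.single i c := by
    rw [← (hs.pullback (baseChangeProj p K)).basis_apply i, _root_.map_smul, Module.Basis.repr_self]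
    simp
  simp only [secFunctional, AddMonoidHom.coe_mk, ZeroHom.coe_mk, h]
  rw [Finset.sum_eq_single i]
  · simp
  · intro j _ hj
    simp [Finsupp.single_eq_of_ne hj]
  · simp

/-- This formula does not mention the frame in its values, so it makes `secFunctional` independent
of the frame and compatible with restriction. -/
lemma secFunctional_smul_pullbackSec (c : Γ(baseChange p K, baseChangeProj p K ⁻¹ᵁ U))
    (x : Γ(E, U)) :
    secFunctional p l hU hs (c • pullbackSec (baseChangeProj p K) E U x) =
      functional p l hU c • x := by
  rw [← hs.basis.sum_repr x]
  simp only [map_sum, IsFrame.basis_apply, Finset.smul_sum, pullbackSec_smul, smul_smul]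
  refine Finset.sum_congr rfl fun i _ ↦ ?_
  rw [secFunctional_smul_frame, mul_comm, functional_smul, mul_comm]

lemma secFunctional_smul (a : Γ(X, U))
    (y : Γ((pullback (baseChangeProj p K)).obj E, baseChangeProj p K ⁻¹ᵁ U)) :
    secFunctional p l hU hs (pullbackFun (baseChangeProj p K) U a • y) =
      a • secFunctional p l hU hs y := by
  rw [← (hs.pullback (baseChangeProj p K)).basis.sum_repr y]
  simp only [map_sum, IsFrame.basis_apply, Finset.smul_sum, smul_smul,
    secFunctional_smul_frame, functional_smul]

lemma secFunctional_res (h : V ≤ U)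
    (y : Γ((pullback (baseChangeProj p K)).obj E, baseChangeProj p K ⁻¹ᵁ U)) :
    secFunctional p l hV ht
        (((pullback (baseChangeProj p K)).obj E).res ((baseChangeProj p K).preimage_mono h) y) =
      E.res h (secFunctional p l hU hs y) := by
  rw [← (hs.pullback (baseChangeProj p K)).basis.sum_repr y]
  simp only [map_sum, IsFrame.basis_apply, res_smul, secFunctional_smul_frame]
  refine Finset.sum_congr rfl fun i _ ↦ ?_
  rw [← pullbackSec_res, secFunctional_smul_pullbackSec, functional_res p l hU hV h]

/-- The extension of a functional on the scalars induces a map from endomorphisms of the base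
change of a vector bundle to endomorphisms of this vector bundle. -/
lemma exists_hom_functional
    (hE : ∀ x : X, ∃ U : X.Opens, x ∈ U ∧ ∃ (r : ℕ) (s : Fin r → Γ(E, U)), IsFrame E U s)
    (φ : (pullback (baseChangeProj p K)).obj E ⟶ (pullback (baseChangeProj p K)).obj E) :
    ∃ ψ : E ⟶ E, ∀ (U : X.Opens) (hU : IsAffineOpen U) (r : ℕ) (s : Fin r → Γ(E, U))
      (hs : IsFrame E U s) (x : Γ(E, U)), ψ.appLin U x = secFunctional p l hU hs
        (φ.appLin (baseChangeProj p K ⁻¹ᵁ U) (pullbackSec (baseChangeProj p K) E U x)) := by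
  choose hW r s hs using fun W : {W : X.Opens // IsAffineOpen W ∧
      ∃ (r : ℕ) (s : Fin r → Γ(E, W)), IsFrame E W s} ↦ W.2
  have hind (U V : X.Opens) (hU : IsAffineOpen U) (hV : IsAffineOpen V) (r r' : ℕ)
      (s : Fin r → Γ(E, U)) (hs : IsFrame E U s) (t : Fin r' → Γ(E, V)) (ht : IsFrame E V t)
      (h : V ≤ U) (x : Γ(E, U)) : secFunctional p l hV ht
        (φ.appLin (baseChangeProj p K ⁻¹ᵁ V) (pullbackSec (baseChangeProj p K) E V (E.res h x))) =
        E.res h (secFunctional p l hU hs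
        (φ.appLin (baseChangeProj p K ⁻¹ᵁ U) (pullbackSec (baseChangeProj p K) E U x))) := by
    rw [pullbackSec_res, appLin_res, secFunctional_res]
  obtain ⟨ψ, hψ⟩ := exists_hom_of_basis (E := E) (F := E) (exists_affine_frame hE)
    (fun W ↦
      { toFun := fun x ↦ secFunctional p l (hW W) (hs W)
          (φ.appLin (baseChangeProj p K ⁻¹ᵁ W) (pullbackSec (baseChangeProj p K) E W x))
        map_add' := fun x y ↦ by simp only [map_add]
        map_smul' := fun a x ↦ by
          rw [pullbackSec_smul, LinearMap.map_smul, secFunctional_smul, RingHom.id_apply] })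
    fun W W' h x ↦ hind _ _ (hW W) (hW W') _ _ _ (hs W) _ (hs W') h x
  refine ⟨ψ, fun U hU r' s' hs' x ↦ ?_⟩
  have h1 := congr($(hψ ⟨U, hU, r', s', hs'⟩) x)
  refine h1.trans ?_
  -- Restriction from `U` to itself compares the given frame with the chosen one.
  have h2 := hind U U hU (hW ⟨U, hU, r', s', hs'⟩) _ _ _ hs' _ (hs ⟨U, hU, r', s', hs'⟩) le_rfl x
  rw [res_self, res_self] at h2
  exact h2

end Functional

end AlgebraicGeometry.Scheme

/-! ### Conjugating an idempotent into a base change -/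

namespace AlgebraicGeometry.Scheme

open TopologicalSpace TensorProduct

open Modules

section

variable {X : Scheme.{0}} {k K : Type} [Field k] [Field K] [Algebra k K]
  (p : X ⟶ Spec (CommRingCat.of k)) {U : X.Opens} {E : X.Modules}

/-- The matrix, in the pulled back frame, of an endomorphism of a base change. -/
def frameMatrix {r : ℕ} {s : Fin r → Γ(E, U)} (hs : IsFrame E U s)
    (φ : (pullback (baseChangeProj p K)).obj E ⟶ (pullback (baseChangeProj p K)).obj E) :
    Matrix (Fin r) (Fin r) Γ(baseChange p K, baseChangeProj p K ⁻¹ᵁ U) :=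
  LinearMap.toMatrix (hs.pullback (baseChangeProj p K)).basis
    (hs.pullback (baseChangeProj p K)).basis (φ.appLin _)

lemma sum_frameMatrix {r : ℕ} {s : Fin r → Γ(E, U)} (hs : IsFrame E U s)
    (φ : (pullback (baseChangeProj p K)).obj E ⟶ (pullback (baseChangeProj p K)).obj E)
    (j : Fin r) : φ.appLin _ (pullbackSec (baseChangeProj p K) E U (s j)) =
      ∑ i, frameMatrix p hs φ i j • pullbackSec (baseChangeProj p K) E U (s i) := by
  rw [← (hs.pullback (baseChangeProj p K)).basis.sum_repr (φ.appLin _ _)]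
  simp [frameMatrix, LinearMap.toMatrix_apply]

lemma frameMatrix_pullback_map {r : ℕ} {s : Fin r → Γ(E, U)} (hs : IsFrame E U s) (φ : E ⟶ E) :
    frameMatrix p hs ((pullback (baseChangeProj p K)).map φ) =
      (LinearMap.toMatrix hs.basis hs.basis (φ.appLin U)).map
        (pullbackFun (baseChangeProj p K) U) := by
  ext i j
  have h : ((pullback (baseChangeProj p K)).map φ).appLin _
      (pullbackSec (baseChangeProj p K) E U (s j)) =
      ∑ i, pullbackFun (baseChangeProj p K) U (hs.basis.repr (φ.appLin U (s j)) i) •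
        (hs.pullback (baseChangeProj p K)).basis i := by
    rw [pullback_map_appLin]
    conv_lhs => rw [← hs.basis.sum_repr (φ.appLin U (s j))]
    simp [pullbackSec_smul]
  rw [frameMatrix, LinearMap.toMatrix_apply, IsFrame.basis_apply, h, Module.Basis.repr_sum_self,
    Matrix.map_apply, LinearMap.toMatrix_apply, IsFrame.basis_apply]

/-- An idempotent endomorphism of the base change of a vector bundle is conjugate to the base change
of an idempotent endomorphism. -/
theorem exists_idempotent_conjugate [IsAlgClosed k] [IrreducibleSpace X] [IsProper p]
    (hE : ∀ x : X, ∃ U : X.Opens, x ∈ U ∧ ∃ (r : ℕ) (s : Fin r → Γ(E, U)), IsFrame E U s)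
    (e : (pullback (baseChangeProj p K)).obj E ⟶ (pullback (baseChangeProj p K)).obj E)
    (he : e ≫ e = e) :
    ∃ (e₀ : E ⟶ E) (u : (pullback (baseChangeProj p K)).obj E ⟶
        (pullback (baseChangeProj p K)).obj E), e₀ ≫ e₀ = e₀ ∧ IsIso u ∧
      (pullback (baseChangeProj p K)).map e₀ ≫ u = u ≫ e := by
  classical
  have : CompactSpace X := (quasiCompact_iff_compactSpace p).mp inferInstance
  have hcov (x : X) : ∃ W : X.Opens, x ∈ W ∧ IsAffineOpen W ∧
      ∃ (r : ℕ) (s : Fin r → Γ(E, W)), IsFrame E W s := by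
    obtain ⟨_, ⟨W, rfl⟩, hx, -⟩ :=
      Opens.isBasis_iff_nbhd.mp (exists_affine_frame hE) (Opens.mem_top x)
    exact ⟨W, hx, W.2⟩
  choose W hxW hW r s hs using hcov
  obtain ⟨T, hT⟩ := CompactSpace.elim_nhds_subcover (fun x ↦ (W x : Set X))
    fun x ↦ (W x).2.mem_nhds (hxW x)
  have hTcov (x : X) : ∃ y : T, x ∈ W y := by
    obtain ⟨y, hy, hxy⟩ := Set.mem_iUnion₂.mp (hT ▸ Set.mem_univ x : x ∈ ⋃ y ∈ T, (W y : Set X))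
    exact ⟨⟨y, hy⟩, hxy⟩
  let C (x : X) := frameMatrix p (hs x) e
  have hC (x : X) : C x * C x = C x := by
    simp only [C, frameMatrix]
    rw [← LinearMap.toMatrix_comp, ← appLin_comp, he]
  let (x : X) : Algebra k Γ(X, W x) := constantsAlgebra p (W x)
  choose Z hZ using fun x ↦ exists_finset_matrix_mem_range (tensorEquiv p K (hW x)) (C x)
  -- Finiteness of the cover allows one subalgebra and one point to serve every chart.
  obtain ⟨R, σ, l, hR, hl⟩ := exists_specialization (k := k) (T.biUnion Z)
  have hR' (x : T) : (Z x : Set K) ⊆ R :=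
    (Finset.coe_subset.mpr (Finset.subset_biUnion_of_mem Z x.2)).trans hR
  choose C' hC' using fun x : T ↦ hZ x R (hR' x)
  obtain ⟨e₀, he₀⟩ := exists_hom_functional p l hE e
  have hmat (x : X) : LinearMap.toMatrix (hs x).basis (hs x).basis (e₀.appLin (W x)) =
      (C x).map (functional p l (hW x)) := by
    ext i j
    rw [LinearMap.toMatrix_apply, IsFrame.basis_apply, he₀ (W x) (hW x) _ _ (hs x),
      sum_frameMatrix p (hs x), map_sum]
    simp only [secFunctional_smul_frame]
    have := (hs x).basis.repr_sum_self fun i ↦ functional p l (hW x) (C x i j)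
    simp only [IsFrame.basis_apply] at this
    rw [this]
    rfl
  have he₀' : e₀ ≫ e₀ = e₀ := by
    refine hom_ext_of_basis (isBasis_le_of_cover (fun x : T ↦ W x) hTcov) fun ⟨V, x, hV⟩ ↦ ?_
    refine (hs x).appLin_eq ?_ hV
    refine (LinearMap.toMatrix (hs x).basis (hs x).basis).injective ?_
    rw [appLin_comp, LinearMap.toMatrix_comp _ (hs x).basis, hmat]
    exact map_extendFunctional_idem _ σ l hl (C x) (C' x) (hC' x) (hC x)
  let e₁ := (pullback (baseChangeProj p K)).map e₀
  have he₁ : e₁ ≫ e₁ = e₁ := by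
    rw [← Functor.map_comp, he₀']
  -- The standard intertwiner of two idempotents; it is the identity when they coincide.
  let u := e₁ ≫ e + (𝟙 _ - e₁) ≫ (𝟙 _ - e)
  refine ⟨e₀, u, he₀', ?_, ?_⟩
  · have hdet (x : X) : LinearMap.det (u.appLin (baseChangeProj p K ⁻¹ᵁ W x)) =
        (C x * frameMatrix p (hs x) e₁ + (1 - C x) * (1 - frameMatrix p (hs x) e₁)).det := by
      rw [← LinearMap.det_toMatrix ((hs x).pullback (baseChangeProj p K)).basis]
      congr 1
      simp only [u, appLin_add, appLin_comp, appLin_sub, appLin_id, map_add, map_sub,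
        LinearMap.toMatrix_comp _ ((hs x).pullback (baseChangeProj p K)).basis,
        LinearMap.toMatrix_id]
      rfl
    have hnil (x : T) (y : X) (hy : y ∈ W x) :
        ¬ IsNilpotent (LinearMap.det (u.appLin (baseChangeProj p K ⁻¹ᵁ W x))) := by
      have : Nonempty (W x) := ⟨⟨y, hy⟩⟩
      rw [hdet]
      refine not_isNilpotent_det _ (tensorEquiv_tmul p (hW x)) σ l hl (C x) (C' x) (hC' x) (hC x)
        _ ?_
      rw [frameMatrix_pullback_map, hmat]
      rfl
    obtain ⟨d, hd⟩ := exists_det (fun x : T ↦ baseChangeProj p K ⁻¹ᵁ W x) (fun y ↦ hTcov _)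
      _ (fun x ↦ (hs x).pullback (baseChangeProj p K)) u
    have hdu : IsUnit d := by
      refine (isNilpotent_or_isUnit p d).resolve_left fun hz ↦ ?_
      -- One nonempty chart is enough: non-nilpotence there forces the global determinant to be a
      -- unit everywhere.
      obtain ⟨y⟩ : Nonempty X := inferInstance
      obtain ⟨x, hx⟩ := hTcov y
      refine hnil x y hx ?_
      rw [← hd]
      exact hz.map _
    refine isIso_of_isUnit_det (fun x : T ↦ baseChangeProj p K ⁻¹ᵁ W x) (fun y ↦ hTcov _) _
      (fun x ↦ (hs x).pullback (baseChangeProj p K)) u fun x ↦ ?_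
    rw [← hd]
    exact hdu.map _
  · change e₁ ≫ u = u ≫ e
    simp [u, Preadditive.comp_sub, Preadditive.sub_comp, reassoc_of% he₁, he, he₁]

end

end AlgebraicGeometry.Scheme

/-! ### Descent of the summand -/

namespace AlgebraicGeometry.Scheme

open Modules

section

variable {X : Scheme.{0}} {k K : Type} [Field k] [Field K] [Algebra k K]
  (p : X ⟶ Spec (CommRingCat.of k)) {E : X.Modules}

/-- A retract of the base change of a vector bundle is the base change of a vector bundle. -/
theorem exists_baseChange_iso_of_retract [IsAlgClosed k] [IrreducibleSpace X] [IsProper p]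
    (hE : IsVectorBundle E) {V : (baseChange p K).Modules}
    (i : V ⟶ (pullback (baseChangeProj p K)).obj E)
    (q : (pullback (baseChangeProj p K)).obj E ⟶ V) (hiq : i ≫ q = 𝟙 V) :
    ∃ V₀ : X.Modules, IsVectorBundle V₀ ∧
      Nonempty (V ≅ (pullback (baseChangeProj p K)).obj V₀) := by
  have hE' (x : X) : ∃ U : X.Opens, x ∈ U ∧ ∃ (r : ℕ) (s : Fin r → Γ(E, U)), IsFrame E U s := by
    obtain ⟨U, hx, r, ⟨φ⟩⟩ := hE x
    exact ⟨U, hx, r, exists_isFrame_of_restrict_iso φ⟩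
  obtain ⟨e₀, u, he₀, _, hu⟩ :=
    exists_idempotent_conjugate p hE' (q ≫ i) (by simp [reassoc_of% hiq])
  obtain ⟨V₀, i₀, q₀, h₁, h₂⟩ := IsIdempotentComplete.idempotents_split E e₀ he₀
  -- The image of `e` is `V` and that of `e₀ ⊗ K` is the pullback of `V₀`; conjugation by `u`
  -- carries one to the other.
  refine ⟨V₀, fun x ↦ ?_, ⟨i ≫ inv u ≫ (pullback (baseChangeProj p K)).map q₀,
    (pullback (baseChangeProj p K)).map i₀ ≫ u ≫ q, ?_, ?_⟩⟩
  · obtain ⟨U, hx, r, s, hs⟩ := hE' x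
    obtain ⟨W, hxW, m, t, ht⟩ := hs.exists_isFrame_summand h₁ hx
    exact ⟨W, hxW, m, ht.nonempty_restrict_iso⟩
  · rw [← h₂, Functor.map_comp] at hu
    have : inv u ≫ (pullback (baseChangeProj p K)).map q₀ ≫
        (pullback (baseChangeProj p K)).map i₀ ≫ u = q ≫ i := by
      rw [IsIso.inv_comp_eq, ← hu, Category.assoc]
    simp only [Category.assoc]
    rw [reassoc_of% this, reassoc_of% hiq, hiq]
  · have : u ≫ q ≫ i ≫ inv u = (pullback (baseChangeProj p K)).map e₀ := by
      rw [← Category.assoc q, ← Category.assoc u, ← hu, Category.assoc, IsIso.hom_inv_id,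
        Category.comp_id]
    simp only [Category.assoc]
    rw [reassoc_of% this, ← Functor.map_comp, ← Functor.map_comp, ← h₂, Category.assoc, h₁,
      Category.comp_id, h₁]
    exact CategoryTheory.Functor.map_id _ _

end

end AlgebraicGeometry.Scheme

end

theorem lemma3p2 (M₀ : Scheme.{0}) (p : M₀ ⟶ Spec (CommRingCat.of QBar))
    (hM₀ : IsSmoothProjectiveCurve p) (E₀ : M₀.Modules) (hE₀ : IsVectorBundle E₀)
    (V F : (complexification p).Modules)
    (i : V ⟶ baseChangeToComplex p E₀) (j : F ⟶ baseChangeToComplex p E₀)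
    (hVF : IsIso (Limits.biprod.desc i j)) :
    ∃ V₀ : M₀.Modules, IsVectorBundle V₀ ∧ Nonempty (V ≅ baseChangeToComplex p V₀) := by
  have := hM₀.isProper
  have := hM₀.irreducible
  have : IsAlgClosed QBar := (algebraicClosure.isAlgClosure ℚ ℂ).isAlgClosed
  let q : baseChangeToComplex p E₀ ⟶ V := inv (Limits.biprod.desc i j) ≫ Limits.biprod.fst
  have hiq : i ≫ q = 𝟙 V := by
    have hi : i = Limits.biprod.inl ≫ Limits.biprod.desc i j := by simp
    rw [hi, Category.assoc, IsIso.hom_inv_id_assoc, Limits.biprod.inl_fst]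
  exact Scheme.exists_baseChange_iso_of_retract p hE₀ (K := ℂ) i q hiq
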